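/- Consider a slotted-time single-user model with state $(B(t),X(t))\in\{0,1\}\times\{1,2,\dots\}$, where $B(t)=1$ means that a packet has just been generated and $X(t)$ is the age of information. Packets are generated in each slot independently with probability $\lambda\in(0,1]$. In the controllable states $(1,i)$ one may attempt to transmit ($A(t)=1$); an attempt succeeds independently with probability $\mu\in(0,1]$, and then the age drops to $1$; otherwise (failure or no attempt) the age increases by one. In the states $(0,i)$ no attempt is possible. Let $p=\lambda\mu$, $q=1-p$, and let $(c_i)_{i\ge1}$ be a nonnegative nondecreasing sequence of costs with $\sum_{i\ge1}c_iq^i<\infty$. For a charge $\nu\in\mathbb R$ consider the minimization, over stationary (possibly randomized) policies $\pi$, of the long-run average objective $$J_\nu^\pi(b,i)=\limsup_{T\to\infty}\frac1T\,\mathbb E_{(b,i)}^\pi\Big[\sum_{t=0}^T\big(c_{X(t)}+\nu A(t)\big)\Big].$$ An action is called optimal in $(1,i)$ for $\nu$ if it attains the minimum in Bellman's average-cost equation $$g+h(0,i)=c_i+\mathbb E[h(Y')\mid (0,i),0],\qquad g+h(1,i)=\min_{a\in\{0,1\}}\{c_i+\nu a+\mathbb E[h(Y')\mid(1,i),a]\},$$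 where $Y'$ is the next state, for some solution $(g,h)$ such that $g=\inf_\pi J_\nu^\pi(b,i)$ for every $(b,i)$ and $h$ is bounded below. A function $w$ of $i\ge 1$ is the Whittle index if for every $\nu\in\mathbb R$ and $i\ge1$: attempting to transmit is optimal in $(1,i)$ iff $w(i)\ge\nu$; not attempting is optimal in $(1,i)$ iff $w(i)\le\nu$; and every stationary policy taking only optimal actions minimizes $J_\nu^\pi(b,i)$ for every initial state $(b,i)$. The model is indexable if it has a Whittle index. For $k\in\{0,1,2,\dots\}\cup\{\infty\}$ the $k$-policy attempts to transmit in $(1,j)$ iff $j>k$. The model is threshold-indexable if it is indexable and for every $\nu\in\mathbb R$ some $k$-policy minimizes $J_\nu^\pi(b,i)$ for every initial state. For $0<\beta<1$ and finite $k$, let $F^{\langle a,k\rangle}_{\beta,(1,i)}$ and $G^{\langle a,k\rangle}_{\beta,(1,i)}$ be the expected total $\beta$-discounted cost $\sum_t\beta^tc_{X(t)}$ and number of attempts $\sum_t\beta^tA(t)$ from $(1,i)$ when action $a$ is taken at time $0$ and the $k$-policy is followed from time $1$ on, and put $f^k_{\beta,(1,i)}=F^{\langle0,k\rangle}_{\beta,(1,i)}-F^{\langle1,k\rangle}_{\beta,(1,i)}$,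 $g^k_{\beta,(1,i)}=G^{\langle1,k\rangle}_{\beta,(1,i)}-G^{\langle0,k\rangle}_{\beta,(1,i)}$. Then the model is threshold-indexable under the average criterion, and its Whittle index is $$m_{(1,i)}=\mu\Big[i\,p\,C_{i+1}(q)-\sum_{j=1}^ic_j\Big],\qquad C_{i+1}(q)=\sum_{j=1}^\infty q^{j-1}c_{i+j}\quad(i\ge1),$$ with $q^0=1$, also for $q=0$. Moreover, it is the marginal productivity index under the average criterion: the limits $f^i_{(1,i)}=\lim_{\beta\uparrow1}f^i_{\beta,(1,i)}$ and $g^k_{(1,i)}=\lim_{\beta\uparrow1}g^k_{\beta,(1,i)}$ exist for all $i\ge1$, $k\ge0$, one has $g^k_{(1,i)}>0$, and $m_{(1,i)}=f^i_{(1,i)}/g^i_{(1,i)}$. -/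

import Mathlib

open Filter Topology

noncomputable section

namespace AoI

/-- A state `(b, i)`: `b` tells whether a packet has just been generated, `i ≥ 1` is the age of
information. The controllable states are `(true, i)`, the uncontrollable ones `(false, i)`. -/
abbrev State := Bool × ℕ+

/-- One-slot transition probability from `y` to `y'` under action `a` (`true` is "attempt to
transmit"). The next packet arrives with probability `lam`, independently of the transmission.
If a transmission is attempted (this needs a packet), it succeeds with probability `mu` and the age
drops to `1`. Otherwise the age grows by one; note that `i + 1 ≠ 1` in `ℕ+`. -/
def trans (lam mu : ℝ) (a : Bool) (y y' : State) : ℝ :=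
  (if y'.1 then lam else 1 - lam) *
    (if y'.2 = y.2 + 1 then 1 - (if a && y.1 then mu else 0)
      else if y'.2 = 1 then (if a && y.1 then mu else 0)
      else 0)

/-- Stationary (possibly randomized) policies of the single-user model: `π i` is the probability
of attempting to transmit in the controllable state `(1, i)`. Nothing can be transmitted in the
uncontrollable states. -/
abbrev Policy := ℕ+ → unitInterval

/-- The probability that the policy `π` attempts to transmit in state `y`. -/
def attempt (π : Policy) (y : State) : ℝ := if y.1 then (π y.2 : ℝ) else 0

/-- One-slot transition probabilities of the Markov chain controlled by the policy `π`. -/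
def policyTrans (lam mu : ℝ) (π : Policy) (y y' : State) : ℝ :=
  (1 - attempt π y) * trans lam mu false y y' + attempt π y * trans lam mu true y y'

/-- The law of `Y(t)` under the policy `π` from `Y(0) = y`: `law lam mu π t y y'` is the
probability that `Y(t) = y'`, i.e. the `t`-step transition probability. -/
def law (lam mu : ℝ) (π : Policy) : ℕ → State → State → ℝ
  | 0, y, y' => if y' = y then 1 else 0
  | t + 1, y, y' => ∑' z, policyTrans lam mu π y z * law lam mu π t z y'

/-- The expectation of `f (Y(t))` under the policy `π` from `Y(0) = y`. (The law of `Y(t)` has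
finite support, so that no integrability is needed.) -/
def mean (lam mu : ℝ) (π : Policy) (t : ℕ) (y : State) (f : State → ℝ) : ℝ :=
  ∑' y', law lam mu π t y y' * f y'

/-- The `k`-threshold policy attempts to transmit in state `(1, j)` if and only if `j > k`; for
`k = ∞` it never does. -/
def threshold (k : ℕ∞) : Policy := fun j => if k < ((j : ℕ) : ℕ∞) then 1 else 0

section Average

/-- The long-run average of the cost `c_{X(t)}` plus the charge `ν` per transmission attempt,
`limsup_T (1/T) E[∑_{t=0}^T (c_{X(t)} + ν A(t))]`. The conditional expectation of `A(t)` given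
`Y(t) = z` is `attempt π z`. -/
def avgObjective (lam mu : ℝ) (c : ℕ+ → ℝ) (ν : ℝ) (π : Policy) (y : State) : EReal :=
  limsup (fun T : ℕ =>
    (((∑ t ∈ Finset.range (T + 1),
      mean lam mu π t y (fun z => c z.2 + ν * attempt π z)) / (T : ℝ) : ℝ) : EReal)) atTop

/-- The policy `π` solves the average-cost single-user problem with charge `ν`, from every
initial state. -/
def IsAvgOptimal (lam mu : ℝ) (c : ℕ+ → ℝ) (ν : ℝ) (π : Policy) : Prop :=
  ∀ (y : State) (π' : Policy),
    avgObjective lam mu c ν π y ≤ avgObjective lam mu c ν π' y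

/-- One-slot cost of action `a` in state `y` plus the expectation of `h` at the next state. -/
def actionValue (lam mu : ℝ) (c : ℕ+ → ℝ) (ν : ℝ) (h : State → ℝ) (a : Bool) (y : State) : ℝ :=
  c y.2 + ν * (if a then 1 else 0) + ∑' y', trans lam mu a y y' * h y'

/-- `(g, h)` is the gain and a relative value function of the average-cost single-user problem
with charge `ν`: `g` is the optimal average cost from every initial state, `h` is bounded below,
and `(g, h)` solves Bellman's (average-cost optimality) equation. -/
structure IsBellmanSolution (lam mu : ℝ) (c : ℕ+ → ℝ) (ν g : ℝ) (h : State → ℝ) : Prop where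
  gain_eq : ∀ y : State, ⨅ π : Policy, avgObjective lam mu c ν π y = (g : EReal)
  bddBelow : ∃ B : ℝ, ∀ y, B ≤ h y
  uncontrollable : ∀ i : ℕ+,
    g + h (false, i) = actionValue lam mu c ν h false (false, i)
  controllable : ∀ i : ℕ+,
    g + h (true, i) =
      min (actionValue lam mu c ν h false (true, i)) (actionValue lam mu c ν h true (true, i))

/-- Action `a` is optimal in the controllable state `(1, i)` for the average-cost problem with
charge `ν`: it attains the minimum in Bellman's equation. -/
def IsOptimalAction (lam mu : ℝ) (c : ℕ+ → ℝ) (ν : ℝ) (a : Bool) (i : ℕ+) : Prop :=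
  ∃ (g : ℝ) (h : State → ℝ), IsBellmanSolution lam mu c ν g h ∧
    actionValue lam mu c ν h a (true, i) ≤ actionValue lam mu c ν h (!a) (true, i)

/-- `w` is the Whittle index under the average criterion: for every charge `ν`, attempting to
transmit is optimal in `(1, j)` iff `w j ≥ ν`, not attempting is optimal in `(1, j)` iff
`w j ≤ ν`, and every stationary policy that only takes optimal actions solves the average-cost
problem from every initial state. -/
structure IsWhittleIndex (lam mu : ℝ) (c : ℕ+ → ℝ) (w : ℕ+ → ℝ) : Prop where
  active_iff : ∀ (ν : ℝ) (j : ℕ+), IsOptimalAction lam mu c ν true j ↔ ν ≤ w j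
  passive_iff : ∀ (ν : ℝ) (j : ℕ+), IsOptimalAction lam mu c ν false j ↔ w j ≤ ν
  optimal : ∀ (ν : ℝ) (π : Policy),
    (∀ j, (π j ≠ 0 → IsOptimalAction lam mu c ν true j) ∧
      (π j ≠ 1 → IsOptimalAction lam mu c ν false j)) →
    IsAvgOptimal lam mu c ν π

/-- Threshold-indexability under the average criterion: the model is indexable, and threshold
policies are optimal for every charge. -/
def ThresholdIndexable (lam mu : ℝ) (c : ℕ+ → ℝ) : Prop :=
  (∃ w : ℕ+ → ℝ, IsWhittleIndex lam mu c w) ∧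
    ∀ ν : ℝ, ∃ k : ℕ∞, IsAvgOptimal lam mu c ν (threshold k)

end Average

section Discounted

/-- The `β`-discounted cost metric `F_y^k` of the `k`-policy from state `y`. -/
def discCost (lam mu : ℝ) (c : ℕ+ → ℝ) (β : ℝ) (k : ℕ) (y : State) : ℝ :=
  ∑' t : ℕ, β ^ t * mean lam mu (threshold k) t y (fun z => c z.2)

/-- The `β`-discounted work metric `G_y^k` of the `k`-policy from state `y`. -/
def discWork (lam mu : ℝ) (β : ℝ) (k : ℕ) (y : State) : ℝ :=
  ∑' t : ℕ, β ^ t * mean lam mu (threshold k) t y (attempt (threshold k))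

/-- The cost metric from `(1, i)` of the policy that takes action `a` at time `0` and follows the
`k`-policy from time `1` onward. -/
def initCost (lam mu : ℝ) (c : ℕ+ → ℝ) (β : ℝ) (a : Bool) (k : ℕ) (i : ℕ+) : ℝ :=
  c i + β * ∑' y', trans lam mu a (true, i) y' * discCost lam mu c β k y'

/-- The work metric from `(1, i)` of the policy that takes action `a` at time `0` and follows the
`k`-policy from time `1` onward. -/
def initWork (lam mu : ℝ) (β : ℝ) (a : Bool) (k : ℕ) (i : ℕ+) : ℝ :=
  (if a then 1 else 0) + β * ∑' y', trans lam mu a (true, i) y' * discWork lam mu β k y'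

/-- The discounted marginal cost metric `f_{(1,i)}^k`. -/
def margCost (lam mu : ℝ) (c : ℕ+ → ℝ) (β : ℝ) (k : ℕ) (i : ℕ+) : ℝ :=
  initCost lam mu c β false k i - initCost lam mu c β true k i

/-- The discounted marginal work metric `g_{(1,i)}^k`. -/
def margWork (lam mu : ℝ) (β : ℝ) (k : ℕ) (i : ℕ+) : ℝ :=
  initWork lam mu β true k i - initWork lam mu β false k i

/-- `m` is the marginal productivity index under the average criterion: the average marginal
metrics exist as limits of the discounted ones as `β ↑ 1`, the marginal work metrics are positive,
and `m i = f_{(1,i)}^i / g_{(1,i)}^i`. -/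
def IsAvgMPIndex (lam mu : ℝ) (c : ℕ+ → ℝ) (m : ℕ+ → ℝ) : Prop :=
  ∃ (f : ℕ+ → ℝ) (g : ℕ → ℕ+ → ℝ),
    (∀ i : ℕ+, Tendsto (fun β : ℝ => margCost lam mu c β i i) (𝓝[<] 1) (𝓝 (f i))) ∧
    (∀ (k : ℕ) (i : ℕ+), Tendsto (fun β : ℝ => margWork lam mu β k i) (𝓝[<] 1) (𝓝 (g k i))) ∧
    (∀ (k : ℕ) (i : ℕ+), 0 < g k i) ∧
    ∀ i : ℕ+, m i = f i / g i i

end Discounted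

/-- `C_{i+1}(q) = ∑_{j ≥ 1} q^{j-1} c_{i+j}`; for `q = 0` this is `c_{i+1}`. -/
def tailCost (c : ℕ+ → ℝ) (q : ℝ) (i : ℕ+) : ℝ :=
  ∑' j : ℕ, q ^ j * c (i + j.succPNat)

/-- The closed form `μ [i p C_{i+1}(q) - ∑_{j=1}^i c_j]` with `p = λ μ` and `q = 1 - p`. -/
def closedForm (lam mu : ℝ) (c : ℕ+ → ℝ) (i : ℕ+) : ℝ :=
  mu * ((i : ℝ) * (lam * mu) * tailCost c (1 - lam * mu) i - ∑ j ∈ Finset.Icc 1 i, c j)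

end AoI

end

open Filter Topology

noncomputable section

namespace AoI


/-! Arrivals are independent of everything else, so averaging over the packet bit (`bar`) turns the
controlled chain into a chain on the ages alone. Ages are shifted to start at 0, and index `n`
resets with probability `p * u n`, where p = λμ. Put κ = ν/μ, the charge per success, and let D be
the averaged relative value with D 0 = 0. Bellman's equation becomes D n = a n - g + min (D (n+1))
((1-p) D (n+1) + pκ) (`IsRelative`). In state (1,i), attempting is optimal iff κ ≤ D i, and waiting
iff D i ≤ κ; because of the shift, D i is the value of age i+1, the age reached without a success.

For the k-policy, renewal-reward gives g and D explicitly (`gain`, `relCost`). Since the costs are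
nondecreasing, so is `index`. If k is the first number with κ ≤ index (k+1), then `relCost` for k
solves the equation. If there is none, the costs are bounded and never transmitting has gain sup a.
In both cases D i compares with κ exactly as the index does, ties included (`exists_isRelative`).

Optimality is a verification argument by telescoping. D is bounded below, which bounds the average
of policies taking optimal actions from above. The bound for arbitrary policies needs a subsolution
bounded above, and D is unbounded when the costs are; truncating the costs and lowering the gain
slightly gives bounded subsolutions with gains as close to g as desired
(`exists_isBoundedSub_of_threshold`). An action counts as optimal if some Bellman solution says so,
hence the need for `IsRelative.unique`.

The marginal productivity index comes from vanishing discount: differences of discounted totals tend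
to `relCost` with κ = 0 (`tendsto_discSum_sub`), and at k = i the ratio of the limits is the closed
form by algebra. -/

/-- The average of `f` over the arrival in the states of age `n + 1`. -/
def bar (lam : ℝ) (f : State → ℝ) (n : ℕ) : ℝ :=
  lam * f (true, n.succPNat) + (1 - lam) * f (false, n.succPNat)

/-- The one-step operator of the age chain (ages shifted by one) which from `n` resets to `0` with
probability `p * u n` and otherwise moves to `n + 1`. -/
def step (p : ℝ) (u w : ℕ → ℝ) (n : ℕ) : ℝ :=
  (1 - p * u n) * w (n + 1) + p * u n * w 0

/-- The attempt probabilities of a policy, as a function of the age minus one. -/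
def prob (π : Policy) (n : ℕ) : ℝ := π n.succPNat

/-! ### Reduction of the controlled chain to the age chain -/

theorem hasSum_trans (lam mu : ℝ) (a b : Bool) (i : ℕ+) (f : State → ℝ) :
    HasSum (fun y' => trans lam mu a (b, i) y' * f y')
      ((1 - if a && b then mu else 0) * bar lam f i + (if a && b then mu else 0) * bar lam f 0) := by
  have hi : i + 1 ≠ 1 := by
    intro h
    have := congrArg PNat.val h
    simp at this
  have hs : (i : ℕ).succPNat = i + 1 := PNat.eq (by simp)
  have h0 : Nat.succPNat 0 = 1 := rfl
  have key := hasSum_sum_of_ne_finset_zero (L := .unconditional _) (f := fun y' => trans lam mu a (b, i) y' * f y')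
    (s := (Finset.univ : Finset Bool) ×ˢ ({i + 1, 1} : Finset ℕ+)) (by
      rintro ⟨b', j⟩ hj
      simp only [Finset.mem_product, Finset.mem_univ, true_and, Finset.mem_insert,
        Finset.mem_singleton, not_or] at hj
      simp [trans, hj.1, hj.2])
  convert key using 1
  rw [Finset.sum_product]
  simp only [Fintype.sum_bool, Finset.sum_pair hi, trans, bar, hs, h0, hi.symm]
  generalize (if (a && b) = true then mu else 0) = m
  simp
  ring

theorem hasSum_policyTrans (lam mu : ℝ) (π : Policy) (y : State) (f : State → ℝ) :
    HasSum (fun y' => policyTrans lam mu π y y' * f y')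
      ((1 - mu * attempt π y) * bar lam f y.2 + mu * attempt π y * bar lam f 0) := by
  obtain ⟨b, i⟩ := y
  have key := ((hasSum_trans lam mu false b i f).mul_left (1 - attempt π (b, i))).add
    ((hasSum_trans lam mu true b i f).mul_left (attempt π (b, i)))
  have hv : (1 - mu * attempt π (b, i)) * bar lam f i + mu * attempt π (b, i) * bar lam f 0 =
      (1 - attempt π (b, i)) * ((1 - if false && b then mu else 0) * bar lam f i
        + (if false && b then mu else 0) * bar lam f 0)
      + attempt π (b, i) * ((1 - if true && b then mu else 0) * bar lam f i
        + (if true && b then mu else 0) * bar lam f 0) := by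
    cases b <;> simp [attempt]
    ring
  rw [hv]
  refine key.congr_fun fun y' => ?_
  simp only [policyTrans]
  ring

theorem law_succ (lam mu : ℝ) (π : Policy) (t : ℕ) (y y' : State) :
    law lam mu π (t + 1) y y' = (1 - mu * attempt π y) * bar lam (fun z => law lam mu π t z y') y.2
      + mu * attempt π y * bar lam (fun z => law lam mu π t z y') 0 :=
  (hasSum_policyTrans lam mu π y _).tsum_eq

theorem finite_support_law (lam mu : ℝ) (π : Policy) (t : ℕ) (y : State) :
    (Function.support (law lam mu π t y)).Finite := by
  induction t generalizing y with
  | zero =>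
    refine (Set.finite_singleton y).subset fun y' hy' => ?_
    by_contra h
    simp only [Set.mem_singleton_iff] at h
    simp [law, h] at hy'
  | succ t ih =>
    refine ((((ih (true, (y.2 : ℕ).succPNat)).union (ih (false, (y.2 : ℕ).succPNat))).union
      (ih (true, Nat.succPNat 0))).union (ih (false, Nat.succPNat 0))).subset fun y' hy' => ?_
    by_contra h
    simp only [Set.mem_union, Function.mem_support, not_or, not_not] at h
    simp [law_succ, bar, h] at hy'

theorem hasSum_mean (lam mu : ℝ) (π : Policy) (t : ℕ) (y : State) (f : State → ℝ) :
    HasSum (fun y' => law lam mu π t y y' * f y') (mean lam mu π t y f) :=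
  (summable_of_hasFiniteSupport ((finite_support_law lam mu π t y).subset
    (Function.support_mul_subset_left _ _))).hasSum

theorem mean_zero (lam mu : ℝ) (π : Policy) (y : State) (f : State → ℝ) :
    mean lam mu π 0 y f = f y := by
  simp [mean, law]

theorem mean_succ_bar (lam mu : ℝ) (π : Policy) (t : ℕ) (y : State) (f : State → ℝ) :
    mean lam mu π (t + 1) y f =
      (1 - mu * attempt π y) * bar lam (fun z => mean lam mu π t z f) y.2
        + mu * attempt π y * bar lam (fun z => mean lam mu π t z f) 0 := by
  have h := fun n : ℕ => ((hasSum_mean lam mu π t (true, n.succPNat) f).mul_left lam).add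
    ((hasSum_mean lam mu π t (false, n.succPNat) f).mul_left (1 - lam))
  refine HasSum.unique (hasSum_mean lam mu π (t + 1) y f) ?_
  refine (((h y.2).mul_left (1 - mu * attempt π y)).add
    ((h 0).mul_left (mu * attempt π y))).congr_fun fun y' => ?_
  rw [law_succ]
  simp only [bar]
  ring

/-- The packet bit at time 0 is given rather than random, so only the averaged mean is a pure power
of `step`. `mean_succ` therefore peels off the first slot, in which the actual bit matters. -/
theorem bar_mean (lam mu : ℝ) (π : Policy) (t : ℕ) (f : State → ℝ) :
    bar lam (fun z => mean lam mu π t z f) = (step (lam * mu) (prob π))^[t] (bar lam f) := by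
  induction t with
  | zero =>
    funext n
    simp [bar, mean_zero]
  | succ t ih =>
    rw [Function.iterate_succ_apply', ← ih]
    funext n
    conv_lhs => rw [bar, mean_succ_bar, mean_succ_bar]
    simp only [step, attempt, prob, if_true, Nat.succPNat_coe, Nat.succ_eq_add_one]
    simp
    ring

theorem mean_succ (lam mu : ℝ) (π : Policy) (t : ℕ) (y : State) (f : State → ℝ) :
    mean lam mu π (t + 1) y f =
      (1 - mu * attempt π y) * (step (lam * mu) (prob π))^[t] (bar lam f) y.2
        + mu * attempt π y * (step (lam * mu) (prob π))^[t] (bar lam f) 0 := by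
  rw [mean_succ_bar, bar_mean]

theorem attempt_mem (π : Policy) (y : State) : 0 ≤ attempt π y ∧ attempt π y ≤ 1 := by
  obtain ⟨b, i⟩ := y
  cases b
  · simp [attempt]
  · simpa [attempt] using ⟨(π i).2.1, (π i).2.2⟩

theorem prob_mem (π : Policy) (n : ℕ) : 0 ≤ prob π n ∧ prob π n ≤ 1 :=
  ⟨(π _).2.1, (π _).2.2⟩

/-! ### Monotonicity and telescoping for the age chain -/

section Step

variable {p : ℝ} {u v w : ℕ → ℝ}

theorem step_mono (hp : 0 ≤ p) (hp1 : p ≤ 1) (hu : ∀ n, 0 ≤ u n ∧ u n ≤ 1) (h : ∀ n, v n ≤ w n)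
    (n : ℕ) : step p u v n ≤ step p u w n := by
  have h1 : p * u n ≤ 1 := mul_le_one₀ hp1 (hu n).1 (hu n).2
  have h2 : 0 ≤ p * u n := mul_nonneg hp (hu n).1
  exact add_le_add (mul_le_mul_of_nonneg_left (h _) (by linarith))
    (mul_le_mul_of_nonneg_left (h _) h2)

theorem iterate_step_mono (hp : 0 ≤ p) (hp1 : p ≤ 1) (hu : ∀ n, 0 ≤ u n ∧ u n ≤ 1)
    (h : ∀ n, v n ≤ w n) (t n : ℕ) : (step p u)^[t] v n ≤ (step p u)^[t] w n := by
  induction t generalizing n with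
  | zero => exact h n
  | succ t ih =>
    rw [Function.iterate_succ_apply', Function.iterate_succ_apply']
    exact step_mono hp hp1 hu ih n

theorem step_add (v w : ℕ → ℝ) : step p u (v + w) = step p u v + step p u w := by
  funext n
  simp only [step, Pi.add_apply]
  ring

theorem iterate_step_add (v w : ℕ → ℝ) (t : ℕ) :
    (step p u)^[t] (v + w) = (step p u)^[t] v + (step p u)^[t] w := by
  induction t with
  | zero => rfl
  | succ t ih => simp only [Function.iterate_succ_apply', ih, step_add]

theorem iterate_step_const (K : ℝ) (t : ℕ) :
    (step p u)^[t] (fun _ => K) = fun _ => K := by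
  induction t with
  | zero => rfl
  | succ t ih =>
    rw [Function.iterate_succ_apply', ih]
    funext n
    simp only [step]
    ring

/-- Telescoping of an inequality of Poisson type, from below. -/
theorem sum_iterate_step_ge (hp : 0 ≤ p) (hp1 : p ≤ 1) (hu : ∀ n, 0 ≤ u n ∧ u n ≤ 1)
    {ρ D : ℕ → ℝ} {g : ℝ} (h : ∀ n, D n + g ≤ ρ n + step p u D n) (t n : ℕ) :
    t * g + D n - (step p u)^[t] D n ≤ ∑ s ∈ Finset.range t, (step p u)^[s] ρ n := by
  induction t with
  | zero => simp
  | succ t ih =>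
    have := iterate_step_mono (v := D + fun _ => g) (w := ρ + step p u D) hp hp1 hu h t n
    rw [iterate_step_add, iterate_step_add, iterate_step_const, ← Function.iterate_succ_apply]
      at this
    simp only [Pi.add_apply] at this
    rw [Finset.sum_range_succ]
    push_cast
    linarith

/-- Telescoping of an inequality of Poisson type, from above. -/
theorem sum_iterate_step_le (hp : 0 ≤ p) (hp1 : p ≤ 1) (hu : ∀ n, 0 ≤ u n ∧ u n ≤ 1)
    {ρ D : ℕ → ℝ} {g : ℝ} (h : ∀ n, ρ n + step p u D n ≤ D n + g) (t n : ℕ) :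
    ∑ s ∈ Finset.range t, (step p u)^[s] ρ n ≤ t * g + D n - (step p u)^[t] D n := by
  induction t with
  | zero => simp
  | succ t ih =>
    have := iterate_step_mono (w := D + fun _ => g) (v := ρ + step p u D) hp hp1 hu h t n
    rw [iterate_step_add, iterate_step_add, iterate_step_const, ← Function.iterate_succ_apply]
      at this
    simp only [Pi.add_apply] at this
    rw [Finset.sum_range_succ]
    push_cast
    linarith

end Step

/-! ### Verification bounds for the average objective -/

section Objective

variable {lam mu : ℝ} {c : ℕ+ → ℝ} {ν : ℝ} {π : Policy}

theorem bar_stageCost (n : ℕ) :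
    bar lam (fun z => c z.2 + ν * attempt π z) n = c n.succPNat + lam * ν * prob π n := by
  simp [bar, attempt, prob]
  ring

theorem sum_mean (y : State) (f : State → ℝ) (T : ℕ) :
    ∑ t ∈ Finset.range (T + 1), mean lam mu π t y f = f y
      + ((1 - mu * attempt π y) *
          ∑ t ∈ Finset.range T, (step (lam * mu) (prob π))^[t] (bar lam f) y.2
        + mu * attempt π y *
          ∑ t ∈ Finset.range T, (step (lam * mu) (prob π))^[t] (bar lam f) 0) := by
  rw [Finset.sum_range_succ', mean_zero, Finset.mul_sum, Finset.mul_sum, ← Finset.sum_add_distrib,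
    add_comm]
  congr 1
  exact Finset.sum_congr rfl fun t _ => mean_succ lam mu π t y f

theorem tendsto_affine_div (A g : ℝ) :
    Tendsto (fun T : ℕ => (((T * g + A) / T : ℝ) : EReal)) atTop (𝓝 (g : EReal)) := by
  refine (continuous_coe_real_ereal.tendsto g).comp ?_
  have h : Tendsto (fun T : ℕ => g + A / T) atTop (𝓝 (g + 0)) :=
    tendsto_const_nhds.add (tendsto_const_div_atTop_nhds_zero_nat A)
  rw [add_zero] at h
  refine h.congr' ?_
  filter_upwards [eventually_gt_atTop 0] with T hT
  have : (T : ℝ) ≠ 0 := by positivity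
  field_simp

/-- Telescoping leaves the boundary term `D n` minus the mean of D after T steps; an upper bound on
D alone makes it at least a constant, which dies after division by T. The companion
`avgObjective_le` needs only a lower bound. -/
theorem le_avgObjective (hlam : 0 < lam) (hlam1 : lam ≤ 1) (hmu : 0 < mu) (hmu1 : mu ≤ 1)
    {D : ℕ → ℝ} {g M : ℝ} (hM : ∀ n, D n ≤ M)
    (h : ∀ n, D n + g ≤ c n.succPNat + lam * ν * prob π n + step (lam * mu) (prob π) D n)
    (y : State) : (g : EReal) ≤ avgObjective lam mu c ν π y := by
  have hp : 0 ≤ lam * mu := by positivity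
  have hp1 : lam * mu ≤ 1 := mul_le_one₀ hlam1 hmu.le hmu1
  set r : State → ℝ := fun z => c z.2 + ν * attempt π z with hr
  set m := mu * attempt π y with hm
  have hm0 : 0 ≤ m := mul_nonneg hmu.le (attempt_mem π y).1
  have hm1 : m ≤ 1 := mul_le_one₀ hmu1 (attempt_mem π y).1 (attempt_mem π y).2
  have key : ∀ T n : ℕ, T * g + (D n - M) ≤
      ∑ s ∈ Finset.range T, (step (lam * mu) (prob π))^[s] (bar lam r) n := by
    intro T n
    have h1 := sum_iterate_step_ge (ρ := bar lam r) hp hp1 (prob_mem π)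
      (fun n => by rw [hr, bar_stageCost]; exact h n) T n
    have h2 := iterate_step_mono (w := fun _ => M) hp hp1 (prob_mem π) hM T n
    rw [iterate_step_const] at h2
    linarith
  rw [← (tendsto_affine_div (r y + (1 - m) * (D y.2 - M) + m * (D 0 - M)) g).limsup_eq]
  refine limsup_le_limsup (Eventually.of_forall fun T => ?_)
  rw [EReal.coe_le_coe_iff]
  refine div_le_div_of_nonneg_right ?_ (Nat.cast_nonneg T)
  rw [sum_mean]
  have h1 := mul_le_mul_of_nonneg_left (key T y.2) (sub_nonneg.2 hm1)
  have h2 := mul_le_mul_of_nonneg_left (key T 0) hm0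
  simp only [← hm]
  nlinarith

theorem avgObjective_le (hlam : 0 < lam) (hlam1 : lam ≤ 1) (hmu : 0 < mu) (hmu1 : mu ≤ 1)
    {D : ℕ → ℝ} {g M : ℝ} (hM : ∀ n, M ≤ D n)
    (h : ∀ n, c n.succPNat + lam * ν * prob π n + step (lam * mu) (prob π) D n ≤ D n + g)
    (y : State) : avgObjective lam mu c ν π y ≤ (g : EReal) := by
  have hp : 0 ≤ lam * mu := by positivity
  have hp1 : lam * mu ≤ 1 := mul_le_one₀ hlam1 hmu.le hmu1
  set r : State → ℝ := fun z => c z.2 + ν * attempt π z with hr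
  set m := mu * attempt π y with hm
  have hm0 : 0 ≤ m := mul_nonneg hmu.le (attempt_mem π y).1
  have hm1 : m ≤ 1 := mul_le_one₀ hmu1 (attempt_mem π y).1 (attempt_mem π y).2
  have key : ∀ T n : ℕ, ∑ s ∈ Finset.range T, (step (lam * mu) (prob π))^[s] (bar lam r) n ≤
      T * g + (D n - M) := by
    intro T n
    have h1 := sum_iterate_step_le (ρ := bar lam r) hp hp1 (prob_mem π)
      (fun n => by rw [hr, bar_stageCost]; exact h n) T n
    have h2 := iterate_step_mono (v := fun _ => M) hp hp1 (prob_mem π) hM T n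
    rw [iterate_step_const] at h2
    linarith
  rw [← (tendsto_affine_div (r y + (1 - m) * (D y.2 - M) + m * (D 0 - M)) g).limsup_eq]
  refine limsup_le_limsup (Eventually.of_forall fun T => ?_)
  rw [EReal.coe_le_coe_iff]
  refine div_le_div_of_nonneg_right ?_ (Nat.cast_nonneg T)
  rw [sum_mean]
  have h1 := mul_le_mul_of_nonneg_left (key T y.2) (sub_nonneg.2 hm1)
  have h2 := mul_le_mul_of_nonneg_left (key T 0) hm0
  simp only [← hm]
  nlinarith

end Objective


/-! ### Gain, relative cost and index of threshold policies -/

section Sequences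

/-- The geometrically weighted tail `∑ j, q ^ j * a (n + j)`. -/
def tail (q : ℝ) (a : ℕ → ℝ) (n : ℕ) : ℝ := ∑' j : ℕ, q ^ j * a (n + j)

/-- The partial sums `∑ j < n, a j`. -/
def cum (a : ℕ → ℝ) (n : ℕ) : ℝ := ∑ j ∈ Finset.range n, a j

/-- The Whittle index divided by the success probability, as a function of the age. -/
def index (p : ℝ) (a : ℕ → ℝ) (i : ℕ) : ℝ := i * (p * tail (1 - p) a i) - cum a i

/-- The average cost of the `k`-policy when the charge per successful transmission is `κ`. -/
def gain (p κ : ℝ) (a : ℕ → ℝ) (k : ℕ) : ℝ :=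
  (p * (cum a k + tail (1 - p) a k) + p * κ) / (1 + k * p)

/-- The relative cost of the `k`-policy. -/
def relCost (p κ : ℝ) (a : ℕ → ℝ) (k n : ℕ) : ℝ :=
  if n ≤ k then n * gain p κ a k - cum a n else tail (1 - p) a n + κ - gain p κ a k / p

variable {p q κ : ℝ} {a b : ℕ → ℝ}

theorem cum_succ (n : ℕ) : cum a (n + 1) = cum a n + a n := Finset.sum_range_succ _ _

theorem summable_tail (hs : Summable fun n => q ^ n * a n) (n : ℕ) :
    Summable fun j => q ^ j * a (n + j) := by
  rcases eq_or_ne q 0 with rfl | hq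
  · refine summable_of_ne_finset_zero (s := {0}) fun j hj => ?_
    simp at hj
    simp [hj]
  · have h := ((summable_nat_add_iff n).2 hs).mul_left (q ^ n)⁻¹
    refine h.congr fun j => ?_
    rw [pow_add, add_comm j n]
    field_simp

theorem tail_succ (hs : Summable fun n => q ^ n * a n) (n : ℕ) :
    tail q a n = a n + q * tail q a (n + 1) := by
  rw [tail, (summable_tail hs n).tsum_eq_zero_add, tail, ← tsum_mul_left]
  simp only [pow_zero, one_mul, add_zero]
  congr 2
  funext j
  rw [pow_succ, show n + 1 + j = n + (j + 1) by ring]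
  ring

theorem tail_le_tail (hq : 0 ≤ q) (hsa : Summable fun n => q ^ n * a n)
    (hsb : Summable fun n => q ^ n * b n) {m n : ℕ} (h : ∀ j, a (m + j) ≤ b (n + j)) :
    tail q a m ≤ tail q b n :=
  (summable_tail hsa m).tsum_le_tsum
    (fun j => mul_le_mul_of_nonneg_left (h j) (pow_nonneg hq j)) (summable_tail hsb n)

theorem tail_mono (hq : 0 ≤ q) (hs : Summable fun n => q ^ n * a n) (ha : Monotone a) :
    Monotone (tail q a) := fun _ _ h =>
  tail_le_tail hq hs hs fun _ => ha (Nat.add_le_add_right h _)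

theorem summable_const_mul_pow (hq : 0 ≤ q) (hq1 : q < 1) (K : ℝ) :
    Summable fun n : ℕ => q ^ n * K :=
  (summable_geometric_of_lt_one hq hq1).mul_right K

theorem tail_const (hq : 0 ≤ q) (hq1 : q < 1) (K : ℝ) (n : ℕ) :
    tail q (fun _ => K) n = K / (1 - q) := by
  rw [tail, tsum_mul_right, tsum_geometric_of_lt_one hq hq1]
  ring

theorem le_mul_tail (hp : 0 < p) (hp1 : p ≤ 1) (hs : Summable fun n => (1 - p) ^ n * a n)
    (ha : Monotone a) (n : ℕ) : a n ≤ p * tail (1 - p) a n := by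
  have h := tail_le_tail (m := 0) (n := n) (by linarith)
    (summable_const_mul_pow (by linarith) (by linarith) (a n)) hs
    fun j => ha (Nat.le_add_right n j)
  rw [tail_const (by linarith) (by linarith), sub_sub_cancel, div_le_iff₀ hp] at h
  linarith

theorem mul_tail_le (hp : 0 < p) (hp1 : p ≤ 1) (hs : Summable fun n => (1 - p) ^ n * a n)
    {K : ℝ} {n : ℕ} (h : ∀ j, a (n + j) ≤ K) : p * tail (1 - p) a n ≤ K := by
  have h := tail_le_tail (m := n) (n := 0) (by linarith) hs
    (summable_const_mul_pow (by linarith) (by linarith) K) h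
  rw [tail_const (by linarith) (by linarith), sub_sub_cancel, le_div_iff₀ hp] at h
  linarith

theorem cum_add_tail_succ (hs : Summable fun n => (1 - p) ^ n * a n) (n : ℕ) :
    cum a (n + 1) + tail (1 - p) a (n + 1) =
      cum a n + tail (1 - p) a n + p * tail (1 - p) a (n + 1) := by
  rw [cum_succ, tail_succ hs n]
  ring

/-- With T the tail, index (n+1) - index n = (1 + n p) (p T (n+1) - a n). The last factor is
nonnegative because p T (n+1) is a weighted mean of costs at indices beyond n. -/
theorem index_mono (hp : 0 < p) (hp1 : p ≤ 1) (hs : Summable fun n => (1 - p) ^ n * a n)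
    (ha : Monotone a) : Monotone (index p a) := by
  refine monotone_nat_of_le_succ fun n => ?_
  have h1 := tail_succ hs n
  have h2 := (ha n.le_succ).trans (le_mul_tail hp hp1 hs ha (n + 1))
  have h3 : 0 ≤ (1 + n * p) * (p * tail (1 - p) a (n + 1) - a n) :=
    mul_nonneg (by positivity) (by linarith)
  simp only [index, cum_succ]
  rw [h1]
  push_cast
  nlinarith

theorem gain_mul (hp : 0 < p) (k : ℕ) :
    gain p κ a k * (1 + k * p) = p * (cum a k + tail (1 - p) a k) + p * κ :=
  div_mul_cancel₀ _ (by positivity)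

theorem relCost_of_le {k n : ℕ} (h : n ≤ k) :
    relCost p κ a k n = n * gain p κ a k - cum a n := if_pos h

/-- The two branches of `relCost` agree at `n = k`; this matching condition is precisely the
equation defining `gain`. -/
theorem relCost_of_ge (hp : 0 < p) {k n : ℕ} (h : k ≤ n) :
    relCost p κ a k n = tail (1 - p) a n + κ - gain p κ a k / p := by
  rcases h.eq_or_lt with rfl | h
  · rw [relCost_of_le le_rfl]
    have := gain_mul (κ := κ) (a := a) hp k
    field_simp
    linarith
  · exact if_neg (not_le.2 h)

theorem relCost_eq_of_lt {k n : ℕ} (h : n < k) :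
    relCost p κ a k n = a n - gain p κ a k + relCost p κ a k (n + 1) := by
  rw [relCost_of_le h.le, relCost_of_le h, cum_succ]
  push_cast
  ring

theorem relCost_eq_of_ge (hp : 0 < p) (hs : Summable fun n => (1 - p) ^ n * a n) {k n : ℕ}
    (h : k ≤ n) : relCost p κ a k n =
      a n - gain p κ a k + ((1 - p) * relCost p κ a k (n + 1) + p * κ) := by
  rw [relCost_of_ge hp h, relCost_of_ge hp (h.trans n.le_succ), tail_succ hs n]
  field_simp
  ring

/-- `gain ≤ p T_k ↔ κ ≤ index k`. -/
theorem gain_le_iff (hp : 0 < p) (k : ℕ) :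
    gain p κ a k ≤ p * tail (1 - p) a k ↔ κ ≤ index p a k := by
  rw [gain, div_le_iff₀ (by positivity), index, ← mul_le_mul_iff_right₀ hp (b := κ)]
  constructor <;> intro h <;> nlinarith

/-- The left side says that the relative cost of the k-policy at k+1 is at least κ, so that
attempting is already right at age k+1. The shift from index k comes from T k = a k + (1-p) T (k+1).
-/
theorem gain_le_succ_iff (hp : 0 < p) (hs : Summable fun n => (1 - p) ^ n * a n) (k : ℕ) :
    gain p κ a k ≤ p * tail (1 - p) a (k + 1) ↔ κ ≤ index p a (k + 1) := by
  rw [gain, div_le_iff₀ (by positivity), index, ← mul_le_mul_iff_right₀ hp (b := κ), cum_succ,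
    tail_succ hs k]
  push_cast
  constructor <;> intro h <;> nlinarith

/-- For ages above the threshold, `p T_i ≤ gain` exactly if the index is at most the charge. -/
theorem le_gain_iff (hp : 0 < p) (hp1 : p ≤ 1) (hs : Summable fun n => (1 - p) ^ n * a n)
    (ha : Monotone a) {k i : ℕ} (hk : κ ≤ index p a (k + 1)) (hi : k + 1 ≤ i) :
    p * tail (1 - p) a i ≤ gain p κ a k ↔ index p a i ≤ κ := by
  have hT := tail_mono (by linarith) hs ha
  have hg := (gain_le_succ_iff hp hs k).2 hk
  set g := gain p κ a k with hgdef
  have hmul := gain_mul (κ := κ) (a := a) hp k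
  rw [← hgdef] at hmul
  have hindex : index p a i ≤ κ ↔ (1 + i * p) * (p * tail (1 - p) a i) ≤
      p * (cum a i + tail (1 - p) a i) + p * κ := by
    rw [index, ← mul_le_mul_iff_right₀ hp (c := κ)]
    constructor <;> intro h <;> nlinarith
  rw [hindex]
  -- The quantity p (cum a n + T n) + pκ equals g (1 + k p) at n = k and grows by p · p T (n+1) at
  -- each step. For k ≤ n < i this increment lies between p g and p · p T i, whence the two bounds;
  -- they settle the case of an index that stays equal to κ beyond the threshold.
  have hlow : ∀ n, k ≤ n → g * (1 + n * p) ≤ p * (cum a n + tail (1 - p) a n) + p * κ := by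
    intro n hn
    induction n, hn using Nat.le_induction with
    | base => exact hmul.le
    | succ n hn ih =>
      have h1 := mul_le_mul_of_nonneg_left (hT (Nat.succ_le_succ hn)) hp.le
      have h2 := mul_le_mul_of_nonneg_left (hg.trans h1) hp.le
      rw [cum_add_tail_succ hs]
      push_cast
      nlinarith
  have hup : ∀ n, k ≤ n → n ≤ i → p * (cum a n + tail (1 - p) a n) + p * κ ≤
      g * (1 + k * p) + (n - k) * p * (p * tail (1 - p) a i) := by
    intro n hn
    induction n, hn using Nat.le_induction with
    | base => intro; simpa using hmul.ge
    | succ n hn ih =>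
      intro hni
      have h1 := mul_le_mul_of_nonneg_left (hT hni) hp.le
      have h2 := mul_le_mul_of_nonneg_left h1 hp.le
      have h3 := ih (by omega)
      rw [cum_add_tail_succ hs]
      push_cast
      nlinarith
  constructor
  · intro h
    refine le_trans ?_ (hlow i (by omega))
    rw [mul_comm]
    exact mul_le_mul_of_nonneg_right h (by positivity)
  · intro h
    have h1 := h.trans (hup i (by omega) le_rfl)
    have h2 : p * tail (1 - p) a i * (1 + k * p) ≤ g * (1 + k * p) := by nlinarith
    exact le_of_mul_le_mul_right h2 (by positivity)

/-! ### Truncated costs -/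

theorem summable_min (hq : 0 ≤ q) (hq1 : q < 1) (h0 : ∀ n, 0 ≤ a n) (N : ℕ) :
    Summable fun n => q ^ n * min (a n) (a N) :=
  (summable_const_mul_pow hq hq1 (a N)).of_nonneg_of_le
    (fun n => mul_nonneg (pow_nonneg hq n) (le_min (h0 n) (h0 N)))
    fun n => mul_le_mul_of_nonneg_left (min_le_right _ _) (pow_nonneg hq n)

theorem tendsto_tail_min (hq : 0 ≤ q) (hs : Summable fun n => q ^ n * a n) (h0 : ∀ n, 0 ≤ a n)
    (ha : Monotone a) (n : ℕ) :
    Tendsto (fun N => tail q (fun j => min (a j) (a N)) n) atTop (𝓝 (tail q a n)) := by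
  refine tendsto_tsum_of_dominated_convergence (summable_tail hs n) (fun j => ?_)
    (Eventually.of_forall fun N j => ?_)
  · refine tendsto_const_nhds.congr' ?_
    filter_upwards [eventually_ge_atTop (n + j)] with N hN
    rw [min_eq_left (ha hN)]
  · rw [Real.norm_of_nonneg (mul_nonneg (pow_nonneg hq j) (le_min (h0 _) (h0 _)))]
    exact mul_le_mul_of_nonneg_left (min_le_left _ _) (pow_nonneg hq j)

theorem cum_min (ha : Monotone a) {n N : ℕ} (h : n ≤ N) :
    cum (fun j => min (a j) (a N)) n = cum a n :=
  Finset.sum_congr rfl fun _ hj =>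
    min_eq_left (ha ((Finset.mem_range.1 hj).le.trans h))

theorem tendsto_gain_min (hp1 : p ≤ 1) (hs : Summable fun n => (1 - p) ^ n * a n)
    (h0 : ∀ n, 0 ≤ a n) (ha : Monotone a) (k : ℕ) :
    Tendsto (fun N => gain p κ (fun j => min (a j) (a N)) k) atTop (𝓝 (gain p κ a k)) := by
  have h1 : Tendsto (fun N => cum (fun j => min (a j) (a N)) k) atTop (𝓝 (cum a k)) :=
    tendsto_const_nhds.congr' (by
      filter_upwards [eventually_ge_atTop k] with N hN
      rw [cum_min ha hN])
  exact (((h1.add (tendsto_tail_min (by linarith) hs h0 ha k)).const_mul p).add_const _).div_const _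

/-! ### Existence of solutions of the averaged Bellman equation -/

/-- A solution of the averaged Bellman equation. -/
def IsRelative (p κ : ℝ) (a : ℕ → ℝ) (g : ℝ) (D : ℕ → ℝ) : Prop :=
  ∀ n, D n = a n - g + min (D (n + 1)) ((1 - p) * D (n + 1) + p * κ)

/-- A bounded subsolution of the averaged Bellman equation. -/
def IsBoundedSub (p κ : ℝ) (a : ℕ → ℝ) (g : ℝ) (D : ℕ → ℝ) : Prop :=
  D 0 = 0 ∧ (∃ M, ∀ n, D n ≤ M) ∧
    ∀ n, D n ≤ a n - g + min (D (n + 1)) ((1 - p) * D (n + 1) + p * κ)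

theorem min_eq_left_of_le (hp : 0 < p) {x : ℝ} (h : x ≤ κ) : min x ((1 - p) * x + p * κ) = x :=
  min_eq_left (by nlinarith)

theorem min_eq_right_of_le (hp : 0 < p) {x : ℝ} (h : κ ≤ x) :
    min x ((1 - p) * x + p * κ) = (1 - p) * x + p * κ :=
  min_eq_right (by nlinarith)

/-- Truncated costs give bounded subsolutions whose gains approximate that of the `k`-policy. -/
theorem exists_isBoundedSub_of_threshold (hp : 0 < p) (hp1 : p ≤ 1)
    (hs : Summable fun n => (1 - p) ^ n * a n) (h0 : ∀ n, 0 ≤ a n) (ha : Monotone a) {k : ℕ}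
    (hg : gain p κ a k ≤ p * tail (1 - p) a (k + 1))
    (hlow : ∀ n, 1 ≤ n → n ≤ k → relCost p κ a k n ≤ κ) {ε : ℝ} (hε : 0 < ε) :
    ∃ g D, gain p κ a k - ε ≤ g ∧ IsBoundedSub p κ a g D := by
  have hq : 0 ≤ 1 - p := by linarith
  have hq1 : 1 - p < 1 := by linarith
  have e1 := (tendsto_gain_min (κ := κ) hp1 hs h0 ha k).eventually
    (lt_mem_nhds (show gain p κ a k - ε / 2 < gain p κ a k by linarith))
  have e2 := ((tendsto_tail_min hq hs h0 ha (k + 1)).const_mul p).eventually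
    (lt_mem_nhds (show gain p κ a k - ε / 2 < p * tail (1 - p) a (k + 1) by linarith))
  obtain ⟨N, hN1, hN2, hkN⟩ := (e1.and (e2.and (eventually_ge_atTop k))).exists
  set b : ℕ → ℝ := fun j => min (a j) (a N) with hb
  have hsb : Summable fun n => (1 - p) ^ n * b n := summable_min hq hq1 h0 N
  have hbm : Monotone b := fun i j h => min_le_min_right _ (ha h)
  have hba : ∀ n, b n ≤ a n := fun n => min_le_left _ _
  have hT := tail_mono hq hsb hbm
  have hgle : gain p κ b k ≤ gain p κ a k := by
    have h1 := tail_le_tail (m := k) (n := k) hq hsb hs fun _ => hba _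
    have h2 : cum b k = cum a k := cum_min ha hkN
    rw [gain, gain, h2]
    gcongr
  -- One ε/2 is the loss of gain caused by truncation. The other compensates for p T (k+1), which
  -- truncation may push below the gain and so spoil the inequality at and above the threshold.
  refine ⟨gain p κ b k - ε / 2, relCost p κ b k, by linarith, ?_, ?_, fun n => ?_⟩
  · rw [relCost_of_le (Nat.zero_le k)]
    simp [cum]
  · refine ⟨max (k * |gain p κ b k|) (a N / p + κ - gain p κ b k / p), fun n => ?_⟩
    rcases le_total n k with hn | hn
    · refine le_max_of_le_left ?_
      rw [relCost_of_le hn]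
      have h1 : 0 ≤ cum b n := Finset.sum_nonneg fun j _ => le_min (h0 j) (h0 N)
      have h2 : (n : ℝ) * gain p κ b k ≤ k * |gain p κ b k| :=
        (mul_le_mul_of_nonneg_left (le_abs_self _) (Nat.cast_nonneg n)).trans
          (mul_le_mul_of_nonneg_right (by exact_mod_cast hn) (abs_nonneg _))
      linarith
    · refine le_max_of_le_right ?_
      rw [relCost_of_ge hp hn]
      have h1 : p * tail (1 - p) b n ≤ a N := mul_tail_le hp hp1 hsb fun _ => min_le_right _ _
      have h2 : tail (1 - p) b n ≤ a N / p := by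
        rw [le_div_iff₀ hp]
        linarith
      linarith
  · have hban := hba n
    rw [← min_add_add_left]
    rcases lt_or_ge n k with hn | hn
    · have h1 : relCost p κ b k (n + 1) ≤ κ := by
        refine le_trans ?_ (hlow (n + 1) (by omega) hn)
        rw [relCost_of_le hn, relCost_of_le hn, hb, cum_min ha (by omega)]
        gcongr
      rw [relCost_eq_of_lt hn]
      refine le_min (by linarith) (by nlinarith)
    · have h1 : gain p κ b k - ε / 2 ≤ p * tail (1 - p) b (n + 1) := by
        have := mul_le_mul_of_nonneg_left (hT (Nat.succ_le_succ hn)) hp.le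
        linarith
      have h2 : p * relCost p κ b k (n + 1) =
          p * tail (1 - p) b (n + 1) + p * κ - gain p κ b k := by
        rw [relCost_of_ge hp (by omega)]
        field_simp
      rw [relCost_eq_of_ge hp hsb hn]
      refine le_min (by linarith) (by linarith)

/-- The hypotheses give g ≤ p T (k+1) and, if k ≥ 1, also p T k < g. The second makes the costs
below the threshold at most g, so D increases from 0 up to k and stays below κ at positive indices;
the first, with T nondecreasing, keeps D at or above κ beyond k. Hence the minimum is attained where
the k-policy acts. -/
theorem exists_isRelative_of_threshold (hp : 0 < p) (hp1 : p ≤ 1)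
    (hs : Summable fun n => (1 - p) ^ n * a n) (h0 : ∀ n, 0 ≤ a n) (ha : Monotone a) {k : ℕ}
    (hk : κ ≤ index p a (k + 1)) (hlt : ∀ i, 1 ≤ i → i ≤ k → index p a i < κ) :
    ∃ g D, D 0 = 0 ∧ IsRelative p κ a g D ∧ (∃ B, ∀ n, B ≤ D n) ∧
      (∀ i, 1 ≤ i → ((κ ≤ D i ↔ κ ≤ index p a i) ∧ (D i ≤ κ ↔ index p a i ≤ κ))) ∧
      ∀ ε, 0 < ε → ∃ g' D', g - ε ≤ g' ∧ IsBoundedSub p κ a g' D' := by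
  have hq : 0 ≤ 1 - p := by linarith
  have hT := tail_mono hq hs ha
  have hg := (gain_le_succ_iff hp hs k).2 hk
  set g := gain p κ a k with hgdef
  have hinc : ∀ i, 1 ≤ i → i ≤ k → a (i - 1) ≤ g := by
    intro i hi hik
    have h1 := mt (gain_le_iff hp k).1 (not_le.2 (hlt k (hi.trans hik) le_rfl))
    have h2 := le_mul_tail hp hp1 hs ha k
    have h3 := ha (show i - 1 ≤ k by omega)
    linarith
  have hlow : ∀ n, n ≤ k → 0 ≤ relCost p κ a k n := by
    intro n
    induction n with
    | zero => intro; rw [relCost_of_le (Nat.zero_le k)]; simp [cum]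
    | succ n ih =>
      intro hn
      have h1 := ih (by omega)
      have h2 := hinc (n + 1) (by omega) hn
      rw [relCost_eq_of_lt hn] at h1
      simp only [Nat.add_sub_cancel] at h2
      linarith
  have hmul : ∀ n, k ≤ n →
      p * relCost p κ a k n = p * tail (1 - p) a n + p * κ - g := by
    intro n hn
    rw [relCost_of_ge hp hn, ← hgdef]
    field_simp
  have hge : ∀ n, k + 1 ≤ n → κ ≤ relCost p κ a k n := by
    intro n hn
    have h1 := mul_le_mul_of_nonneg_left (hT hn) hp.le
    have h2 := hmul n (by omega)
    exact le_of_mul_le_mul_left (by linarith) hp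
  have hlow' : ∀ n, 1 ≤ n → n ≤ k → relCost p κ a k n < κ := by
    intro n hn hnk
    have hkk : relCost p κ a k k < κ := by
      have h1 := mt (gain_le_iff hp k).1 (not_le.2 (hlt k (hn.trans hnk) le_rfl))
      have h2 := hmul k le_rfl
      exact lt_of_mul_lt_mul_left (by linarith) hp.le
    refine lt_of_le_of_lt ?_ hkk
    refine Nat.decreasingInduction' (P := fun m => relCost p κ a k m ≤ relCost p κ a k k)
      (fun m hm _ ih => ?_) hnk le_rfl
    have h2 := hinc (m + 1) (by omega) hm
    simp only [Nat.add_sub_cancel] at h2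
    rw [relCost_eq_of_lt hm]
    linarith
  refine ⟨g, relCost p κ a k, ?_, fun n => ?_, ⟨min 0 (κ - g / p), fun n => ?_⟩,
    fun i hi => ?_, fun ε hε => exists_isBoundedSub_of_threshold hp hp1 hs h0 ha hg
      (fun n h1 h2 => (hlow' n h1 h2).le) hε⟩
  · exact (relCost_of_le (Nat.zero_le k)).trans (by simp [cum])
  · rcases lt_or_ge n k with hn | hn
    · rw [min_eq_left_of_le hp (hlow' (n + 1) (by omega) hn).le]
      exact relCost_eq_of_lt hn
    · rw [min_eq_right_of_le hp (hge (n + 1) (by omega))]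
      exact relCost_eq_of_ge hp hs hn
  · rcases le_total n k with hn | hn
    · exact min_le_of_left_le (hlow n hn)
    · refine min_le_of_right_le ?_
      have : 0 ≤ tail (1 - p) a n :=
        tsum_nonneg fun j => mul_nonneg (pow_nonneg hq j) (h0 _)
      rw [relCost_of_ge hp hn]
      linarith
  · rcases le_or_gt i k with hik | hik
    · have h1 := hlow' i hi hik
      have h2 := hlt i hi hik
      exact ⟨by constructor <;> intro <;> linarith, by constructor <;> intro <;> linarith⟩
    · have h1 := hge i hik
      have h2 := hk.trans (index_mono hp hp1 hs ha hik)
      refine ⟨by tauto, ?_⟩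
      rw [← le_gain_iff hp hp1 hs ha hk hik, ← hgdef,
        ← mul_le_mul_iff_right₀ hp (b := relCost _ _ _ _ _),
        hmul i (by omega)]
      constructor <;> intro <;> linarith

/-- Since a n ≤ p T n, the hypothesis gives n a n - cum a n < κ, and by monotonicity i a n - cum a i
≤ κ for 1 ≤ i ≤ n. Taking i = 1 bounds the costs; letting n → ∞ gives D i ≤ κ for D i = i g - cum a
i and g = sup a. Equality at i would force a i = g through D (i+1) ≤ κ, and then index i ≥ κ. -/
theorem exists_isRelative_of_forall_lt (hp : 0 < p) (hp1 : p ≤ 1)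
    (hs : Summable fun n => (1 - p) ^ n * a n) (ha : Monotone a)
    (hlt : ∀ i, 1 ≤ i → index p a i < κ) :
    ∃ g D, D 0 = 0 ∧ IsRelative p κ a g D ∧ (∃ B, ∀ n, B ≤ D n) ∧
      (∀ i, 1 ≤ i → ((κ ≤ D i ↔ κ ≤ index p a i) ∧ (D i ≤ κ ↔ index p a i ≤ κ))) ∧
      ∀ ε, 0 < ε → ∃ g' D', g - ε ≤ g' ∧ IsBoundedSub p κ a g' D' := by
  have hcum : ∀ i n, 1 ≤ i → i ≤ n → i * a n - cum a i ≤ κ := by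
    intro i n hi hin
    have h1 : ∀ m, i ≤ m → m ≤ n → i * a n - cum a i ≤ m * a n - cum a m := by
      intro m hm
      induction m, hm using Nat.le_induction with
      | base => intro; exact le_rfl
      | succ m hm ih =>
        intro hmn
        have := ih (by omega)
        have := ha (show m ≤ n by omega)
        rw [cum_succ]
        push_cast
        linarith
    have h2 := h1 n hin le_rfl
    have h3 := mul_le_mul_of_nonneg_left (le_mul_tail hp hp1 hs ha n) (Nat.cast_nonneg (α := ℝ) n)
    have h4 := hlt n (hi.trans hin)
    rw [index] at h4
    linarith
  have hbdd : BddAbove (Set.range a) := by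
    refine ⟨max (a 1) (κ + a 0), ?_⟩
    rintro _ ⟨n, rfl⟩
    rcases Nat.eq_zero_or_pos n with rfl | hn
    · exact le_max_of_le_left (ha (Nat.zero_le 1))
    · refine le_max_of_le_right ?_
      have := hcum 1 n le_rfl hn
      simp [cum] at this
      linarith
  set g := ⨆ n, a n with hgdef
  have hlim : Tendsto a atTop (𝓝 g) := tendsto_atTop_ciSup ha hbdd
  have hag : ∀ n, a n ≤ g := le_ciSup hbdd
  set D : ℕ → ℝ := fun n => n * g - cum a n with hD
  have hD0 : D 0 = 0 := by simp [hD, cum]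
  have hDs : ∀ n, D (n + 1) = D n + (g - a n) := by
    intro n
    simp only [hD, cum_succ]
    push_cast
    ring
  have hDle : ∀ i, 1 ≤ i → D i ≤ κ := by
    intro i hi
    refine le_of_tendsto ((hlim.const_mul (i : ℝ)).sub_const (cum a i)) ?_
    filter_upwards [eventually_ge_atTop i] with n hn
    exact hcum i n hi hn
  have hDlt : ∀ i, 1 ≤ i → D i < κ := by
    intro i hi
    refine lt_of_le_of_ne (hDle i hi) fun h => ?_
    have h1 := hDle (i + 1) (by omega)
    rw [hDs, h] at h1
    have h2 : g ≤ p * tail (1 - p) a i := by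
      have := le_mul_tail hp hp1 hs ha i
      linarith
    have h3 := mul_le_mul_of_nonneg_left h2 (Nat.cast_nonneg (α := ℝ) i)
    have h4 := hlt i hi
    simp only [hD] at h
    rw [index] at h4
    linarith
  have hrel : IsRelative p κ a g D := by
    intro n
    rw [min_eq_left_of_le hp (hDle (n + 1) (by omega)), hDs]
    ring
  refine ⟨g, D, hD0, hrel, ⟨0, fun n => ?_⟩, fun i hi => ?_, fun ε hε =>
    ⟨g, D, by linarith, hD0, ⟨max 0 κ, fun n => ?_⟩, fun n => (hrel n).le⟩⟩
  · induction n with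
    | zero => exact hD0.ge
    | succ n ih => rw [hDs]; linarith [hag n]
  · have h1 := hDlt i hi
    have h2 := hlt i hi
    exact ⟨by constructor <;> intro <;> linarith, by constructor <;> intro <;> linarith⟩
  · rcases Nat.eq_zero_or_pos n with rfl | hn
    · exact hD0.le.trans (le_max_left _ _)
    · exact (hDle n hn).trans (le_max_right _ _)

theorem exists_isRelative (hp : 0 < p) (hp1 : p ≤ 1) (hs : Summable fun n => (1 - p) ^ n * a n)
    (h0 : ∀ n, 0 ≤ a n) (ha : Monotone a) (κ : ℝ) :
    ∃ g D, D 0 = 0 ∧ IsRelative p κ a g D ∧ (∃ B, ∀ n, B ≤ D n) ∧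
      (∀ i, 1 ≤ i → ((κ ≤ D i ↔ κ ≤ index p a i) ∧ (D i ≤ κ ↔ index p a i ≤ κ))) ∧
      ∀ ε, 0 < ε → ∃ g' D', g - ε ≤ g' ∧ IsBoundedSub p κ a g' D' := by
  by_cases h : ∃ k, κ ≤ index p a (k + 1)
  · classical
    refine exists_isRelative_of_threshold hp hp1 hs h0 ha (Nat.find_spec h) fun i hi hik => ?_
    have := Nat.find_min h (show i - 1 < Nat.find h by omega)
    rwa [Nat.sub_add_cancel hi, not_le] at this
  · push Not at h
    refine exists_isRelative_of_forall_lt hp hp1 hs ha fun i hi => ?_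
    have := h (i - 1)
    rwa [Nat.sub_add_cancel hi] at this

/-! ### Uniqueness of the solution bounded below -/

/-- If two solutions first differ at `m + 1`, the smaller one is unbounded below. -/
theorem IsRelative.le_of_eq_prev (hp : 0 < p) (hp1 : p ≤ 1) (ha : Monotone a) {g : ℝ}
    {D E : ℕ → ℝ} (hD : IsRelative p κ a g D) (hE : IsRelative p κ a g E) {B : ℝ}
    (hB : ∀ n, B ≤ D n) {m : ℕ} (h : D m = E m) : E (m + 1) ≤ D (m + 1) := by
  by_contra! hlt
  have h1 : min (D (m + 1)) ((1 - p) * D (m + 1) + p * κ) =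
      min (E (m + 1)) ((1 - p) * E (m + 1) + p * κ) := by
    linarith [hD m, hE m]
  rcases hp1.lt_or_eq with hp1 | rfl
  -- For p < 1 both branches of the minimum are strictly increasing.
  · refine absurd h1 (ne_of_lt (lt_min (min_lt_of_left_lt hlt) (min_lt_of_right_lt ?_)))
    have := mul_lt_mul_of_pos_left hlt (sub_pos.2 hp1)
    linarith
  -- For p = 1 the minimum is flat above κ, so D may be the smaller solution at m+1. Then D falls
  -- short of the cap a (m+1) - g + κ by some δ > 0, is driven to κ - δ at m+2, and from there loses
  -- at least δ per step because the costs do not decrease.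
  · simp only [sub_self, zero_mul, one_mul, zero_add] at h1
    have hκ : κ ≤ D (m + 1) := by
      by_contra! hc
      rw [min_eq_left hc.le] at h1
      rcases min_choice (E (m + 1)) κ with h | h <;> linarith
    have hδ : 0 < a (m + 1) - g - (D (m + 1) - κ) := by
      have := hE (m + 1)
      have := min_le_right (E (m + 2)) ((1 - 1) * E (m + 2) + 1 * κ)
      linarith
    set δ := a (m + 1) - g - (D (m + 1) - κ) with hδdef
    have key : ∀ j : ℕ, D (m + 2 + j) ≤ κ - δ - j * δ := by
      have aux : ∀ n, m + 1 ≤ n → min (D (n + 1)) κ ≤ κ - δ → D (n + 1) ≤ D n - a n + g := by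
        intro n hn hmin
        have h2 := hD n
        simp only [sub_self, zero_mul, one_mul, zero_add] at h2
        rcases min_choice (D (n + 1)) κ with h | h <;> linarith
      intro j
      induction j with
      | zero =>
        have h2 := hD (m + 1)
        simp only [sub_self, zero_mul, one_mul, zero_add] at h2
        have := aux (m + 1) le_rfl (by simp only [hδdef]; linarith)
        simp only [add_zero, Nat.cast_zero, zero_mul]
        have e : m + 2 = m + 1 + 1 := rfl
        rw [e]
        simp only [hδdef]
        linarith
      | succ j ih =>
        have h2 := hD (m + 2 + j)
        simp only [sub_self, zero_mul, one_mul, zero_add] at h2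
        have h3 := ha (show m + 1 ≤ m + 2 + j by omega)
        have h4 : 0 ≤ j * δ := by positivity
        have := aux (m + 2 + j) (by omega) (by linarith)
        have e : m + 2 + (j + 1) = m + 2 + j + 1 := rfl
        rw [e]
        push_cast
        linarith
    obtain ⟨j, hj⟩ := exists_nat_gt ((κ - B) / δ)
    rw [div_lt_iff₀ hδ] at hj
    linarith [key j, hB (m + 2 + j)]

theorem IsRelative.unique (hp : 0 < p) (hp1 : p ≤ 1) (ha : Monotone a) {g : ℝ} {D E : ℕ → ℝ}
    (hD : IsRelative p κ a g D) (hE : IsRelative p κ a g E) (hBD : ∃ B, ∀ n, B ≤ D n)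
    (hBE : ∃ B, ∀ n, B ≤ E n) (h : D 0 = E 0) (n : ℕ) : D n = E n := by
  obtain ⟨B, hB⟩ := hBD
  obtain ⟨B', hB'⟩ := hBE
  induction n with
  | zero => exact h
  | succ n ih =>
    exact le_antisymm (hE.le_of_eq_prev hp hp1 ha hD hB' ih.symm)
      (hD.le_of_eq_prev hp hp1 ha hE hB ih)

end Sequences


/-! ### Translation between ages and shifted indices -/

/-- The cost sequence, indexed by the age minus one. -/
def costSeq (c : ℕ+ → ℝ) (n : ℕ) : ℝ := c n.succPNat

theorem succPNat_add (i : ℕ+) (j : ℕ) : ((i : ℕ) + j).succPNat = i + j.succPNat :=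
  PNat.eq (by simp [add_assoc])

theorem tailCost_eq (c : ℕ+ → ℝ) (q : ℝ) (i : ℕ+) : tailCost c q i = tail q (costSeq c) i := by
  simp only [tailCost, tail, costSeq, succPNat_add]

theorem sum_Icc_eq_cum (c : ℕ+ → ℝ) (i : ℕ+) : ∑ j ∈ Finset.Icc 1 i, c j = cum (costSeq c) i := by
  refine Finset.sum_nbij' PNat.natPred Nat.succPNat (fun j hj => ?_) (fun j hj => ?_)
    (fun j _ => PNat.succPNat_natPred j) (fun j _ => Nat.natPred_succPNat j) (fun j _ => ?_)
  · have h1 : (j : ℕ) ≤ i := (Finset.mem_Icc.1 hj).2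
    have h2 := PNat.natPred_add_one j
    exact Finset.mem_range.2 (by omega)
  · rw [Finset.mem_Icc]
    refine ⟨one_le, ?_⟩
    rw [← PNat.coe_le_coe, Nat.succPNat_coe]
    exact Finset.mem_range.1 hj
  · rw [costSeq, PNat.succPNat_natPred]

theorem closedForm_eq (lam mu : ℝ) (c : ℕ+ → ℝ) (i : ℕ+) :
    closedForm lam mu c i = mu * index (lam * mu) (costSeq c) i := by
  rw [closedForm, index, tailCost_eq, sum_Icc_eq_cum, mul_assoc (i : ℝ)]

theorem monotone_costSeq {c : ℕ+ → ℝ} (h : Monotone c) : Monotone (costSeq c) := fun _ _ hmn =>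
  h (Nat.succPNat_le_succPNat.2 hmn)

theorem summable_costSeq {c : ℕ+ → ℝ} {q : ℝ} (h : Summable fun i : ℕ+ => c i * q ^ (i : ℕ)) :
    Summable fun n => q ^ n * costSeq c n := by
  rcases eq_or_ne q 0 with rfl | hq
  · refine summable_of_ne_finset_zero (s := {0}) fun j hj => ?_
    simp at hj
    simp [hj]
  · refine ((h.comp_injective Nat.succPNat_injective).mul_left q⁻¹).congr fun n => ?_
    simp only [Function.comp_apply, Nat.succPNat_coe, Nat.succ_eq_add_one, costSeq, pow_succ]
    field_simp

/-! ### Bellman's equation and the Whittle index -/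

section Average

variable {lam mu : ℝ} {c : ℕ+ → ℝ} {ν : ℝ}

theorem actionValue_eq (h : State → ℝ) (a b : Bool) (i : ℕ+) :
    actionValue lam mu c ν h a (b, i) = c i + ν * (if a then 1 else 0) +
      ((1 - if a && b then mu else 0) * bar lam h i + (if a && b then mu else 0) * bar lam h 0) := by
  rw [actionValue, (hasSum_trans lam mu a b i h).tsum_eq]

theorem mul_min_add (hlam : 0 ≤ lam) (hmu : 0 < mu) (x : ℝ) :
    lam * min x (ν + (1 - mu) * x) + (1 - lam) * x =
      min x ((1 - lam * mu) * x + lam * mu * (ν / mu)) := by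
  rw [mul_min_of_nonneg _ _ hlam, ← min_add_add_right]
  congr 1
  · ring
  · field_simp
    ring

theorem IsBellmanSolution.isRelative (hlam : 0 < lam) (hmu : 0 < mu)
    {g : ℝ} {h : State → ℝ} (hB : IsBellmanSolution lam mu c ν g h) :
    IsRelative (lam * mu) (ν / mu) (costSeq c) g (fun n => bar lam h n - bar lam h 0) := by
  intro n
  have h0 := hB.uncontrollable n.succPNat
  have h1 := hB.controllable n.succPNat
  simp only [actionValue_eq, Nat.succPNat_coe, Nat.succ_eq_add_one] at h0 h1
  simp only [Bool.and_true, Bool.and_false, if_true, Bool.false_eq_true, if_false, mul_zero,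
    add_zero, sub_zero, one_mul, zero_mul, mul_one] at h0 h1
  set x := bar lam h (n + 1) with hx
  set z := bar lam h 0 with hz
  have h2 : min (c n.succPNat + x) (c n.succPNat + ν + ((1 - mu) * x + mu * z)) =
      c n.succPNat + z + min (x - z) (ν + (1 - mu) * (x - z)) := by
    rw [← min_add_add_left]
    congr 1 <;> ring
  rw [h2] at h1
  rw [← mul_min_add hlam.le hmu]
  have h3 : bar lam h n = lam * h (true, n.succPNat) + (1 - lam) * h (false, n.succPNat) := rfl
  simp only [← hx, h3, costSeq]
  linear_combination lam * h1 + (1 - lam) * h0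

theorem passive_le_iff (hmu : 0 < mu) {h : State → ℝ}
    {i : ℕ+} : actionValue lam mu c ν h false (true, i) ≤ actionValue lam mu c ν h true (true, i) ↔
      bar lam h i - bar lam h 0 ≤ ν / mu := by
  rw [actionValue_eq, actionValue_eq, le_div_iff₀ hmu]
  simp
  constructor <;> intro <;> linarith

theorem active_le_iff (hmu : 0 < mu) {h : State → ℝ}
    {i : ℕ+} : actionValue lam mu c ν h true (true, i) ≤ actionValue lam mu c ν h false (true, i) ↔
      ν / mu ≤ bar lam h i - bar lam h 0 := by
  rw [actionValue_eq, actionValue_eq, div_le_iff₀ hmu]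
  simp
  constructor <;> intro <;> linarith

theorem IsRelative.exists_bar_eq (hlam : 0 < lam) (hmu : 0 < mu) (hmu1 : mu ≤ 1)
    (hc : ∀ i, 0 ≤ c i) {g : ℝ} {D : ℕ → ℝ} (hD0 : D 0 = 0)
    (hD : IsRelative (lam * mu) (ν / mu) (costSeq c) g D) (hB : ∃ B, ∀ n, B ≤ D n)
    (hgain : ∀ y : State, ⨅ π : Policy, avgObjective lam mu c ν π y = (g : EReal)) :
    ∃ h, IsBellmanSolution lam mu c ν g h ∧ bar lam h = D := by
  obtain ⟨B, hB⟩ := hB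
  -- The right-hand side of Bellman's equation minus g, with D in place of `bar lam h`; `IsRelative`
  -- is what makes the average of this h equal to D.
  set h : State → ℝ := fun z =>
    c z.2 - g + (if z.1 then min (D z.2) (ν + (1 - mu) * D z.2) else D z.2) with hh
  have hbar : bar lam h = D := by
    funext n
    rw [hD n, ← mul_min_add hlam.le hmu]
    simp only [bar, hh, costSeq, if_true, Bool.false_eq_true, if_false, Nat.succPNat_coe,
      Nat.succ_eq_add_one]
    ring
  refine ⟨h, ⟨hgain, ⟨-g + min B (ν + (1 - mu) * B), ?_⟩, fun i => ?_, fun i => ?_⟩, hbar⟩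
  · rintro ⟨b, i⟩
    have h1 := hc i
    have h2 : min B (ν + (1 - mu) * B) ≤ min (D i) (ν + (1 - mu) * D i) :=
      min_le_min (hB i) (by
        have := mul_le_mul_of_nonneg_left (hB i) (sub_nonneg.2 hmu1)
        linarith)
    have h3 : min (D i) (ν + (1 - mu) * D i) ≤ D i := min_le_left _ _
    cases b <;> simp only [hh, if_true, Bool.false_eq_true, if_false] <;> linarith
  · rw [actionValue_eq, hbar]
    simp [hh]
    ring
  · rw [actionValue_eq, actionValue_eq, hbar]
    simp [hh, hD0]
    rw [add_assoc, min_add_add_left]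
    ring

/-- A randomized action mixes the two branches of the minimum with weights 1 - u and u, so its value
is at least the minimum. -/
theorem IsBoundedSub.le_avgObjective (hlam : 0 < lam) (hlam1 : lam ≤ 1) (hmu : 0 < mu)
    (hmu1 : mu ≤ 1) {g : ℝ} {D : ℕ → ℝ}
    (hD : IsBoundedSub (lam * mu) (ν / mu) (costSeq c) g D) (π : Policy) (y : State) :
    (g : EReal) ≤ avgObjective lam mu c ν π y := by
  obtain ⟨hD0, ⟨M, hM⟩, hD⟩ := hD
  refine AoI.le_avgObjective hlam hlam1 hmu hmu1 hM (fun n => ?_) y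
  have hu := prob_mem π n
  have h1 := hD n
  have h2 := mul_le_mul_of_nonneg_left
    (min_le_left (D (n + 1)) ((1 - lam * mu) * D (n + 1) + lam * mu * (ν / mu)))
    (sub_nonneg.2 hu.2)
  have h3 := mul_le_mul_of_nonneg_left
    (min_le_right (D (n + 1)) ((1 - lam * mu) * D (n + 1) + lam * mu * (ν / mu))) hu.1
  have e : lam * mu * (ν / mu) = lam * ν := by field_simp
  rw [e] at h1 h2 h3
  simp only [step, hD0, costSeq] at h1 ⊢
  linarith

/-- Where π acts deterministically it picks a minimizing branch; where it properly randomizes, both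
conditions force D = κ, and the two branches coincide. -/
theorem IsRelative.avgObjective_le (hlam : 0 < lam) (hlam1 : lam ≤ 1) (hmu : 0 < mu)
    (hmu1 : mu ≤ 1) {g : ℝ} {D : ℕ → ℝ} (hD0 : D 0 = 0)
    (hD : IsRelative (lam * mu) (ν / mu) (costSeq c) g D) (hB : ∃ B, ∀ n, B ≤ D n) {π : Policy}
    (hπ : ∀ j, (π j ≠ 0 → ν / mu ≤ D j) ∧ (π j ≠ 1 → D j ≤ ν / mu)) (y : State) :
    avgObjective lam mu c ν π y ≤ (g : EReal) := by
  obtain ⟨B, hB⟩ := hB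
  refine AoI.avgObjective_le hlam hlam1 hmu hmu1 hB (fun n => ?_) y
  have hp : 0 < lam * mu := by positivity
  have e : lam * mu * (ν / mu) = lam * ν := by field_simp
  obtain ⟨h1, h2⟩ := hπ n.succPNat
  simp only [Nat.succPNat_coe, Nat.succ_eq_add_one] at h1 h2
  have hn := hD n
  simp only [step, hD0, prob, costSeq] at hn ⊢
  rcases eq_or_ne (π n.succPNat) 0 with h | h
  · rw [min_eq_left_of_le hp (h2 (by simp [h]))] at hn
    simp only [h, Set.Icc.coe_zero]
    linarith
  · have hx := h1 h
    rw [min_eq_right_of_le hp hx, e] at hn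
    rcases eq_or_ne (π n.succPNat) 1 with h' | h'
    · simp only [h', Set.Icc.coe_one]
      linarith
    · have hx' : lam * mu * D (n + 1) = lam * ν := by rw [le_antisymm (h2 h') hx, e]
      linear_combination (π n.succPNat - 1 : ℝ) * (-hx') - hn

end Average

/-- Some threshold policy acts according to a monotone index. -/
theorem exists_threshold {w : ℕ+ → ℝ} (hw : Monotone w) (ν : ℝ) :
    ∃ k : ℕ∞, ∀ j, (threshold k j ≠ 0 → ν ≤ w j) ∧ (threshold k j ≠ 1 → w j ≤ ν) := by
  classical
  by_cases h : ∃ n : ℕ, ν ≤ w n.succPNat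
  · refine ⟨(Nat.find h : ℕ), fun j => ?_⟩
    simp only [threshold, Nat.cast_lt]
    split_ifs with hj
    · refine ⟨fun _ => (Nat.find_spec h).trans (hw ?_), fun h => absurd rfl h⟩
      rw [← PNat.coe_le_coe, Nat.succPNat_coe]
      exact hj
    · refine ⟨fun h => absurd rfl h, fun _ => ?_⟩
      have h1 := PNat.natPred_add_one j
      have h2 := Nat.find_min h (show j.natPred < Nat.find h by omega)
      rw [PNat.succPNat_natPred] at h2
      exact (not_le.1 h2).le
  · push Not at h
    refine ⟨⊤, fun j => ?_⟩
    have h1 := h j.natPred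
    rw [PNat.succPNat_natPred] at h1
    simp [threshold, h1.le]

theorem isWhittleIndex_closedForm {lam mu : ℝ} (hlam : 0 < lam) (hlam1 : lam ≤ 1) (hmu : 0 < mu)
    (hmu1 : mu ≤ 1) {c : ℕ+ → ℝ} (hc : ∀ i, 0 ≤ c i) (hmono : Monotone c)
    (hsum : Summable fun i : ℕ+ => c i * (1 - lam * mu) ^ (i : ℕ)) :
    IsWhittleIndex lam mu c (closedForm lam mu c) ∧ Monotone (closedForm lam mu c) := by
  have hp : 0 < lam * mu := by positivity
  have hp1 : lam * mu ≤ 1 := mul_le_one₀ hlam1 hmu.le hmu1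
  have ha := monotone_costSeq hmono
  have hs := summable_costSeq hsum
  have hw : Monotone (closedForm lam mu c) := by
    intro i j hij
    rw [closedForm_eq, closedForm_eq]
    exact mul_le_mul_of_nonneg_left (index_mono hp hp1 hs ha hij) hmu.le
  have key : ∀ ν : ℝ,
      (∀ j, IsOptimalAction lam mu c ν true j ↔ ν ≤ closedForm lam mu c j) ∧
      (∀ j, IsOptimalAction lam mu c ν false j ↔ closedForm lam mu c j ≤ ν) ∧
      ∀ π : Policy, (∀ j, (π j ≠ 0 → ν ≤ closedForm lam mu c j) ∧
        (π j ≠ 1 → closedForm lam mu c j ≤ ν)) → IsAvgOptimal lam mu c ν π := by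
    intro ν
    obtain ⟨g, D, hD0, hD, hB, hidx, hsub⟩ :=
      exists_isRelative hp hp1 hs (fun n => hc _) ha (ν / mu)
    have hle : ∀ j : ℕ+, (ν / mu ≤ D j ↔ ν ≤ closedForm lam mu c j) := by
      intro j
      rw [(hidx j j.2).1, closedForm_eq, div_le_iff₀' hmu]
    have hge : ∀ j : ℕ+, (D j ≤ ν / mu ↔ closedForm lam mu c j ≤ ν) := by
      intro j
      rw [(hidx j j.2).2, closedForm_eq, le_div_iff₀' hmu]
    have hlow : ∀ (π : Policy) (y : State), (g : EReal) ≤ avgObjective lam mu c ν π y := by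
      intro π y
      have hlim : Tendsto (fun n : ℕ => ((g - 1 / ((n : ℝ) + 1) : ℝ) : EReal)) atTop
          (𝓝 (g : EReal)) := by
        refine (continuous_coe_real_ereal.tendsto g).comp ?_
        simpa using tendsto_one_div_add_atTop_nhds_zero_nat.const_sub g
      refine le_of_tendsto' hlim fun n => ?_
      obtain ⟨g', D', hg', hD'⟩ := hsub (1 / ((n : ℝ) + 1)) (by positivity)
      exact (EReal.coe_le_coe_iff.2 hg').trans
        (hD'.le_avgObjective hlam hlam1 hmu hmu1 π y)
    have hup : ∀ π : Policy, (∀ j, (π j ≠ 0 → ν ≤ closedForm lam mu c j) ∧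
        (π j ≠ 1 → closedForm lam mu c j ≤ ν)) → ∀ y, avgObjective lam mu c ν π y ≤ (g : EReal) :=
      fun π hπ => hD.avgObjective_le hlam hlam1 hmu hmu1 hD0 hB fun j =>
        ⟨fun h => (hle j).2 ((hπ j).1 h), fun h => (hge j).2 ((hπ j).2 h)⟩
    have hgain : ∀ y : State, ⨅ π : Policy, avgObjective lam mu c ν π y = (g : EReal) := by
      intro y
      obtain ⟨k, hk⟩ := exists_threshold hw ν
      exact le_antisymm (iInf_le_of_le (threshold k) (hup _ hk y)) (le_iInf fun π => hlow π y)
    obtain ⟨h, hh, hbar⟩ := hD.exists_bar_eq hlam hmu hmu1 hc hD0 hB hgain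
    -- Optimality of an action is witnessed by an arbitrary Bellman solution. Its gain is forced to
    -- be g, and boundedness below then forces its averaged differences to be D.
    have huniq : ∀ (g' : ℝ) (h' : State → ℝ), IsBellmanSolution lam mu c ν g' h' →
        ∀ n, bar lam h' n - bar lam h' 0 = D n := by
      intro g' h' hh'
      have hg : g' = g := EReal.coe_injective ((hh'.gain_eq (true, 1)).symm.trans (hgain (true, 1)))
      subst hg
      obtain ⟨B, hB'⟩ := hh'.bddBelow
      refine (hh'.isRelative hlam hmu).unique hp hp1 ha hD
        ⟨B - bar lam h' 0, fun n => ?_⟩ hB (by simp [hD0])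
      have h1 := mul_le_mul_of_nonneg_left (hB' (true, n.succPNat)) hlam.le
      have h2 := mul_le_mul_of_nonneg_left (hB' (false, n.succPNat)) (sub_nonneg.2 hlam1)
      have h3 : bar lam h' n = lam * h' (true, n.succPNat) + (1 - lam) * h' (false, n.succPNat) :=
        rfl
      linarith
    refine ⟨fun j => ?_, fun j => ?_, fun π hπ y π' => (hup π hπ y).trans (hlow π' y)⟩
    · rw [← hle]
      constructor
      · rintro ⟨g', h', hh', hj⟩
        rw [← huniq g' h' hh']
        exact (active_le_iff hmu).1 hj
      · intro hj
        refine ⟨g, h, hh, (active_le_iff hmu).2 ?_⟩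
        rwa [hbar, hD0, sub_zero]
    · rw [← hge]
      constructor
      · rintro ⟨g', h', hh', hj⟩
        rw [← huniq g' h' hh']
        exact (passive_le_iff hmu).1 hj
      · intro hj
        refine ⟨g, h, hh, (passive_le_iff hmu).2 ?_⟩
        rwa [hbar, hD0, sub_zero]
  refine ⟨⟨fun ν => (key ν).1, fun ν => (key ν).2.1, fun ν π hπ => (key ν).2.2 π fun j => ?_⟩, hw⟩
  rw [← (key ν).1, ← (key ν).2.1]
  exact hπ j

theorem thresholdIndexable_of_isWhittleIndex {lam mu : ℝ} {c w : ℕ+ → ℝ}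
    (h : IsWhittleIndex lam mu c w) (hw : Monotone w) : ThresholdIndexable lam mu c := by
  refine ⟨⟨w, h⟩, fun ν => ?_⟩
  obtain ⟨k, hk⟩ := exists_threshold hw ν
  refine ⟨k, h.optimal ν _ fun j => ?_⟩
  rw [h.active_iff, h.passive_iff]
  exact hk j


/-! ### Discounted totals and their vanishing-discount limits -/

theorem prob_threshold (k n : ℕ) : prob (threshold k) n = if k ≤ n then 1 else 0 := by
  simp only [prob, threshold, Nat.cast_lt, Nat.succPNat_coe, Nat.succ_eq_add_one, Nat.lt_succ_iff]
  split_ifs <;> simp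

/-- The discounted total of `ρ` along the age chain of the `k`-policy started at `n`. -/
def discSum (p β : ℝ) (k : ℕ) (ρ : ℕ → ℝ) (n : ℕ) : ℝ :=
  ∑' t : ℕ, β ^ t * (step p (prob (threshold k)))^[t] ρ n

section DiscSum

variable {p q β : ℝ} {k : ℕ} {ρ : ℕ → ℝ}

theorem step_threshold_of_lt {n : ℕ} (h : n < k) (w : ℕ → ℝ) :
    step p (prob (threshold k)) w n = w (n + 1) := by
  simp [step, prob_threshold, not_le.2 h]

theorem step_threshold_of_ge {n : ℕ} (h : k ≤ n) (w : ℕ → ℝ) :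
    step p (prob (threshold k)) w n = (1 - p) * w (n + 1) + p * w 0 := by
  simp [step, prob_threshold, h]

theorem tail_nonneg (hq : 0 ≤ q) (h0 : ∀ n, 0 ≤ ρ n) (n : ℕ) : 0 ≤ tail q ρ n :=
  tsum_nonneg fun j => mul_nonneg (pow_nonneg hq j) (h0 _)

theorem iterate_step_nonneg (hp : 0 < p) (hp1 : p ≤ 1) (h0 : ∀ n, 0 ≤ ρ n) (t n : ℕ) :
    0 ≤ (step p (prob (threshold k)))^[t] ρ n := by
  have := iterate_step_mono (v := fun _ => 0) hp.le hp1 (prob_mem (threshold k)) h0 t n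
  rwa [iterate_step_const] at this

/-- The function `tail (1 - p) ρ (max n k)` dominates ρ, and one step of the k-policy raises it by
at most p T k. Means thus grow at most linearly in time even for unbounded ρ, which makes the
discounted sums converge. -/
theorem iterate_step_le (hp : 0 < p) (hp1 : p ≤ 1) (hs : Summable fun n => (1 - p) ^ n * ρ n)
    (h0 : ∀ n, 0 ≤ ρ n) (hρ : Monotone ρ) (t n : ℕ) :
    (step p (prob (threshold k)))^[t] ρ n ≤
      tail (1 - p) ρ (max n k) + t * (p * tail (1 - p) ρ k) := by
  have hq : 0 ≤ 1 - p := by linarith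
  have hT0 := tail_nonneg hq h0
  have hT := tail_mono hq hs hρ
  induction t generalizing n with
  | zero =>
    have h1 := tail_succ hs (max n k)
    have h2 := mul_nonneg hq (hT0 (max n k + 1))
    have h3 := hρ (le_max_left n k)
    simp only [Function.iterate_zero, id_eq, Nat.cast_zero, zero_mul, add_zero]
    linarith
  | succ t ih =>
    rw [Function.iterate_succ_apply']
    refine (step_mono hp.le hp1 (prob_mem _) ih n).trans ?_
    have hK := mul_nonneg hp.le (hT0 k)
    push_cast
    rcases lt_or_ge n k with h | h
    · rw [step_threshold_of_lt h, max_eq_right h, max_eq_right h.le]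
      linarith
    · rw [step_threshold_of_ge h, max_eq_left (h.trans n.le_succ), max_eq_left h,
        max_eq_right (Nat.zero_le k)]
      have h1 := tail_succ hs n
      have h2 := h0 n
      linarith

theorem summable_affine_mul_pow (hβ : 0 ≤ β) (hβ1 : β < 1) (A K : ℝ) :
    Summable fun t : ℕ => β ^ t * (A + t * K) := by
  have h1 := (summable_geometric_of_lt_one hβ hβ1).mul_right A
  have h2 := (summable_pow_mul_geometric_of_norm_lt_one (R := ℝ) 1
    (r := β) (by rwa [Real.norm_of_nonneg hβ])).mul_right K
  refine (h1.add h2).congr fun t => ?_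
  ring

theorem summable_discSum (hp : 0 < p) (hp1 : p ≤ 1) (hs : Summable fun n => (1 - p) ^ n * ρ n)
    (h0 : ∀ n, 0 ≤ ρ n) (hρ : Monotone ρ) (hβ : 0 ≤ β) (hβ1 : β < 1) (k n : ℕ) :
    Summable fun t : ℕ => β ^ t * (step p (prob (threshold k)))^[t] ρ n :=
  (summable_affine_mul_pow hβ hβ1 _ _).of_nonneg_of_le
    (fun t => mul_nonneg (pow_nonneg hβ t) (iterate_step_nonneg hp hp1 h0 t n))
    fun t => mul_le_mul_of_nonneg_left (iterate_step_le hp hp1 hs h0 hρ t n) (pow_nonneg hβ t)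

theorem discSum_eq_step (hp : 0 < p) (hp1 : p ≤ 1) (hs : Summable fun n => (1 - p) ^ n * ρ n)
    (h0 : ∀ n, 0 ≤ ρ n) (hρ : Monotone ρ) (hβ : 0 ≤ β) (hβ1 : β < 1) (n : ℕ) :
    discSum p β k ρ n = ρ n + β * step p (prob (threshold k)) (discSum p β k ρ) n := by
  have hsum := summable_discSum hp hp1 hs h0 hρ hβ hβ1 k
  have h1 := (((hsum (n + 1)).hasSum.mul_left (1 - p * prob (threshold k) n)).add
    ((hsum 0).hasSum.mul_left (p * prob (threshold k) n))).mul_left β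
  rw [discSum, (hsum n).tsum_eq_zero_add]
  simp only [pow_zero, one_mul, Function.iterate_zero, id_eq]
  congr 1
  refine HasSum.tsum_eq (h1.congr_fun fun t => ?_)
  rw [Function.iterate_succ_apply', pow_succ, step]
  ring

theorem discSum_zero (hp : 0 < p) (hp1 : p ≤ 1) (hs : Summable fun n => (1 - p) ^ n * ρ n)
    (h0 : ∀ n, 0 ≤ ρ n) (hρ : Monotone ρ) (hβ : 0 ≤ β) (hβ1 : β < 1) {n : ℕ} (hn : n ≤ k) :
    discSum p β k ρ 0 = ∑ j ∈ Finset.range n, β ^ j * ρ j + β ^ n * discSum p β k ρ n := by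
  induction n with
  | zero => simp
  | succ n ih =>
    rw [ih (by omega), discSum_eq_step hp hp1 hs h0 hρ hβ hβ1 n, step_threshold_of_lt hn,
      Finset.sum_range_succ]
    ring

theorem tendsto_pow_mul_tail (q : ℝ) (ρ : ℕ → ℝ) (n : ℕ) :
    Tendsto (fun m => q ^ m * tail q ρ (n + m)) atTop (𝓝 0) := by
  refine (tendsto_sum_nat_add fun j => q ^ j * ρ (n + j)).congr fun m => ?_
  rw [tail, ← tsum_mul_left]
  congr 1
  funext j
  rw [pow_add, show n + (j + m) = n + m + j by ring]
  ring

theorem summable_mul_pow (hβ : 0 ≤ β) (hβ1 : β ≤ 1) (hq : 0 ≤ q)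
    (hs : Summable fun n => q ^ n * ρ n) (h0 : ∀ n, 0 ≤ ρ n) :
    Summable fun n => (β * q) ^ n * ρ n :=
  hs.of_nonneg_of_le (fun n => mul_nonneg (pow_nonneg (mul_nonneg hβ hq) n) (h0 n)) fun n =>
    mul_le_mul_of_nonneg_right
      (pow_le_pow_left₀ (mul_nonneg hβ hq) (mul_le_of_le_one_left hq hβ1) n) (h0 n)

theorem tail_mul_le_tail (hβ : 0 ≤ β) (hβ1 : β ≤ 1) (hq : 0 ≤ q)
    (hs : Summable fun n => q ^ n * ρ n) (h0 : ∀ n, 0 ≤ ρ n) (n : ℕ) :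
    tail (β * q) ρ n ≤ tail q ρ n :=
  (summable_tail (summable_mul_pow hβ hβ1 hq hs h0) n).tsum_le_tsum (fun j =>
    mul_le_mul_of_nonneg_right
      (pow_le_pow_left₀ (mul_nonneg hβ hq) (mul_le_of_le_one_left hq hβ1) j) (h0 _))
    (summable_tail hs n)

/-- Both sides satisfy the same recursion above the threshold, so their difference E has E n = (β
(1-p))^m E (n+m). Since |E| is at most a multiple of the tail plus a constant, and (1-p)^m T (n+m)
is the remainder of a convergent series, E vanishes. -/
theorem discSum_of_ge (hp : 0 < p) (hp1 : p ≤ 1) (hs : Summable fun n => (1 - p) ^ n * ρ n)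
    (h0 : ∀ n, 0 ≤ ρ n) (hρ : Monotone ρ) (hβ : 0 ≤ β) (hβ1 : β < 1) {n : ℕ} (hn : k ≤ n) :
    discSum p β k ρ n =
      tail (β * (1 - p)) ρ n + β * p * discSum p β k ρ 0 / (1 - β * (1 - p)) := by
  have hq : 0 ≤ 1 - p := by linarith
  have hs' := summable_mul_pow hβ hβ1.le hq hs h0
  have hd : 0 < 1 - β * (1 - p) := by nlinarith
  set z := β * p * discSum p β k ρ 0 / (1 - β * (1 - p)) with hz
  have hz' : z = β * (1 - p) * z + β * p * discSum p β k ρ 0 := by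
    rw [hz]
    field_simp
    ring
  set E : ℕ → ℝ := fun m => discSum p β k ρ m - tail (β * (1 - p)) ρ m - z with hE
  have hrec : ∀ m, E n = (β * (1 - p)) ^ m * E (n + m) := by
    intro m
    induction m with
    | zero => simp
    | succ m ih =>
      have h1 := discSum_eq_step (k := k) hp hp1 hs h0 hρ hβ hβ1 (n + m)
      have h2 := tail_succ hs' (n + m)
      rw [step_threshold_of_ge (hn.trans (Nat.le_add_right n m))] at h1
      have h3 : E (n + m) = β * (1 - p) * E (n + m + 1) := by
        simp only [hE]
        linear_combination h1 - h2 - hz'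
      rw [ih, h3, pow_succ, add_assoc]
      ring
  set K := p * tail (1 - p) ρ k with hK
  have hbound : ∀ m, k ≤ m → |E m| ≤
      tail (1 - p) ρ m * (1 / (1 - β) + 1) + (∑' t : ℕ, β ^ t * (t * K) + |z|) := by
    intro m hm
    have hsum := summable_discSum hp hp1 hs h0 hρ hβ hβ1 k m
    have h1 : 0 ≤ discSum p β k ρ m :=
      tsum_nonneg fun t => mul_nonneg (pow_nonneg hβ t) (iterate_step_nonneg hp hp1 h0 t m)
    have h2 : discSum p β k ρ m ≤
        tail (1 - p) ρ m * (1 / (1 - β)) + ∑' t : ℕ, β ^ t * (t * K) := by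
      have e1 := (summable_geometric_of_lt_one hβ hβ1).mul_right (tail (1 - p) ρ m)
      have e2 : Summable fun t : ℕ => β ^ t * (t * K) := by
        simpa using summable_affine_mul_pow hβ hβ1 0 K
      have e3 : tail (1 - p) ρ m * (1 / (1 - β)) = ∑' t : ℕ, β ^ t * tail (1 - p) ρ m := by
        rw [tsum_mul_right, tsum_geometric_of_lt_one hβ hβ1]
        ring
      rw [e3, ← e1.tsum_add e2]
      refine hsum.tsum_le_tsum (fun t => ?_) (e1.add e2)
      have := iterate_step_le (k := k) hp hp1 hs h0 hρ t m
      rw [max_eq_left hm] at this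
      rw [← mul_add]
      exact mul_le_mul_of_nonneg_left this (pow_nonneg hβ t)
    have h3 := tail_nonneg (mul_nonneg hβ hq) h0 m
    have h4 := tail_mul_le_tail hβ hβ1.le hq hs h0 m
    have h5 := tail_nonneg hq h0 m
    have h6 := neg_abs_le z
    have h7 := le_abs_self z
    rw [abs_le, mul_add, mul_one]
    constructor <;> simp only [hE] <;> linarith
  have hlim : Tendsto (fun m => (1 - p) ^ m * tail (1 - p) ρ (n + m) * (1 / (1 - β) + 1) +
      (1 - p) ^ m * (∑' t : ℕ, β ^ t * (t * K) + |z|)) atTop (𝓝 0) := by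
    simpa using ((tendsto_pow_mul_tail (1 - p) ρ n).mul_const (1 / (1 - β) + 1)).add
      ((tendsto_pow_atTop_nhds_zero_of_lt_one hq (by linarith)).mul_const
        (∑' t : ℕ, β ^ t * (t * K) + |z|))
  have hzero : |E n| ≤ 0 := by
    refine ge_of_tendsto' hlim fun m => ?_
    rw [hrec m, abs_mul, abs_of_nonneg (pow_nonneg (mul_nonneg hβ hq) m), mul_assoc, ← mul_add]
    exact mul_le_mul (pow_le_pow_left₀ (mul_nonneg hβ hq) (mul_le_of_le_one_left hq hβ1.le) m)
      (hbound _ (hn.trans (Nat.le_add_right n m))) (abs_nonneg _) (pow_nonneg hq m)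
  have := abs_nonpos_iff.1 hzero
  simp only [hE] at this
  linarith

/-- The discounted renewal equation over one cycle. The factor 1 - β, which keeps the limit finite,
comes out of 1 - β(1-p) - β^(k+1) p = (1-β)(1 + β p ∑_{j<k} β^j). -/
theorem one_sub_mul_discSum_zero (hp : 0 < p) (hp1 : p ≤ 1)
    (hs : Summable fun n => (1 - p) ^ n * ρ n)
    (h0 : ∀ n, 0 ≤ ρ n) (hρ : Monotone ρ) (hβ : 0 ≤ β) (hβ1 : β < 1) :
    (1 - β) * discSum p β k ρ 0 = (1 - β * (1 - p)) *
      (∑ j ∈ Finset.range k, β ^ j * ρ j + β ^ k * tail (β * (1 - p)) ρ k) /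
        (1 + β * p * ∑ j ∈ Finset.range k, β ^ j) := by
  have h1 := discSum_zero hp hp1 hs h0 hρ hβ hβ1 (le_refl k)
  rw [discSum_of_ge hp hp1 hs h0 hρ hβ hβ1 le_rfl] at h1
  have hd : 0 < 1 - β * (1 - p) := by nlinarith
  have hgeom := geom_sum_mul_neg β k
  have hpos : 0 < 1 + β * p * ∑ j ∈ Finset.range k, β ^ j := by positivity
  set V := discSum p β k ρ 0
  set A := ∑ j ∈ Finset.range k, β ^ j * ρ j
  set T := tail (β * (1 - p)) ρ k
  set G := ∑ j ∈ Finset.range k, β ^ j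
  rw [eq_div_iff hpos.ne']
  have h2 : (1 - β * (1 - p)) * V =
      (1 - β * (1 - p)) * (A + β ^ k * T) + β ^ k * (β * p * V) := by
    nth_rewrite 1 [h1]
    field_simp
    ring
  linear_combination h2 + β * p * V * hgeom

theorem eventually_left_one : ∀ᶠ β : ℝ in 𝓝[<] 1, 0 < β ∧ β < 1 :=
  Ioo_mem_nhdsLT zero_lt_one

theorem tendsto_tail_mul (hq : 0 ≤ q) (hs : Summable fun n => q ^ n * ρ n) (h0 : ∀ n, 0 ≤ ρ n)
    (n : ℕ) : Tendsto (fun β : ℝ => tail (β * q) ρ n) (𝓝[<] 1) (𝓝 (tail q ρ n)) := by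
  refine tendsto_tsum_of_dominated_convergence (summable_tail hs n) (fun j => ?_) ?_
  · have h : Continuous fun β : ℝ => (β * q) ^ j * ρ (n + j) := by fun_prop
    have := h.tendsto 1
    rw [one_mul] at this
    exact this.mono_left nhdsWithin_le_nhds
  · filter_upwards [eventually_left_one] with β hβ j
    have h1 := mul_nonneg hβ.1.le hq
    rw [Real.norm_of_nonneg (mul_nonneg (pow_nonneg h1 j) (h0 _))]
    exact mul_le_mul_of_nonneg_right (pow_le_pow_left₀ h1 (mul_le_of_le_one_left hq hβ.2.le) j)
      (h0 _)

theorem tendsto_sum_pow_mul (b : ℕ → ℝ) (n : ℕ) :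
    Tendsto (fun β : ℝ => ∑ j ∈ Finset.range n, β ^ j * b j) (𝓝[<] 1) (𝓝 (cum b n)) := by
  have h : Continuous fun β : ℝ => ∑ j ∈ Finset.range n, β ^ j * b j := by fun_prop
  have := h.tendsto 1
  simp only [one_pow, one_mul] at this
  exact this.mono_left nhdsWithin_le_nhds

theorem tendsto_sum_pow (n : ℕ) :
    Tendsto (fun β : ℝ => ∑ j ∈ Finset.range n, β ^ j) (𝓝[<] 1) (𝓝 (n : ℝ)) := by
  simpa [cum] using tendsto_sum_pow_mul (fun _ => 1) n

theorem tendsto_id_left : Tendsto (fun β : ℝ => β) (𝓝[<] 1) (𝓝 1) :=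
  tendsto_id.mono_left nhdsWithin_le_nhds

theorem tendsto_one_sub_mul_discSum (hp : 0 < p) (hp1 : p ≤ 1)
    (hs : Summable fun n => (1 - p) ^ n * ρ n) (h0 : ∀ n, 0 ≤ ρ n) (hρ : Monotone ρ) :
    Tendsto (fun β => (1 - β) * discSum p β k ρ 0) (𝓝[<] 1) (𝓝 (gain p 0 ρ k)) := by
  have hq : 0 ≤ 1 - p := by linarith
  have hβ := tendsto_id_left
  have h := (((hβ.mul_const (1 - p)).const_sub 1).mul ((tendsto_sum_pow_mul ρ k).add
    ((hβ.pow k).mul (tendsto_tail_mul hq hs h0 k)))).div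
    (((hβ.mul_const p).mul (tendsto_sum_pow k)).const_add 1) (by positivity)
  have e : gain p 0 ρ k = (1 - 1 * (1 - p)) * (cum ρ k + 1 ^ k * tail (1 - p) ρ k) /
      (1 + 1 * p * k) := by
    rw [gain]
    congr 1 <;> ring
  rw [e]
  refine h.congr' ?_
  filter_upwards [eventually_left_one] with β hβ
  exact (one_sub_mul_discSum_zero hp hp1 hs h0 hρ hβ.1.le hβ.2).symm

/-- The relative discounted totals of the `k`-policy converge to its relative cost. -/
theorem tendsto_discSum_sub (hp : 0 < p) (hp1 : p ≤ 1)
    (hs : Summable fun n => (1 - p) ^ n * ρ n) (h0 : ∀ n, 0 ≤ ρ n) (hρ : Monotone ρ) (k n : ℕ) :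
    Tendsto (fun β => discSum p β k ρ n - discSum p β k ρ 0) (𝓝[<] 1)
      (𝓝 (relCost p 0 ρ k n)) := by
  have hq : 0 ≤ 1 - p := by linarith
  have hβ := tendsto_id_left
  have hV := tendsto_one_sub_mul_discSum (k := k) hp hp1 hs h0 hρ
  rcases le_total n k with hn | hn
  · have h := ((hV.mul (tendsto_sum_pow n)).sub (tendsto_sum_pow_mul ρ n)).div (hβ.pow n)
      (by simp)
    rw [relCost_of_le hn, mul_comm (n : ℝ)]
    simp only [one_pow, div_one] at h
    refine h.congr' ?_
    filter_upwards [eventually_left_one] with β hβ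
    have h1 := discSum_zero hp hp1 hs h0 hρ hβ.1.le hβ.2 hn
    have h2 := geom_sum_mul_neg β n
    have h3 : β ^ n ≠ 0 := (pow_pos hβ.1 n).ne'
    simp only [Pi.div_apply]
    rw [div_eq_iff h3]
    linear_combination discSum p β k ρ 0 * h2 + h1
  · have h := (tendsto_tail_mul hq hs h0 n).sub
      (hV.div ((hβ.mul_const (1 - p)).const_sub 1) (by linarith))
    have e : relCost p 0 ρ k n = tail (1 - p) ρ n - gain p 0 ρ k / (1 - 1 * (1 - p)) := by
      rw [relCost_of_ge hp hn, add_zero, one_mul, sub_sub_cancel]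
    rw [e]
    refine h.congr' ?_
    filter_upwards [eventually_left_one] with β hβ
    have hd : 1 - β * (1 - p) ≠ 0 := by nlinarith [mul_nonneg hβ.1.le hq]
    rw [discSum_of_ge hp hp1 hs h0 hρ hβ.1.le hβ.2 hn]
    simp only [Pi.div_apply]
    field_simp
    ring

end DiscSum

/-! ### Marginal metrics and the marginal productivity index -/

section Marginal

variable {lam mu : ℝ} {c : ℕ+ → ℝ}

theorem bar_tsum_mean (hlam : 0 < lam) (hlam1 : lam ≤ 1) (hmu : 0 < mu) (hmu1 : mu ≤ 1)
    {β : ℝ} (hβ : 0 ≤ β) (hβ1 : β < 1) (k : ℕ) (f : State → ℝ)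
    (hs : Summable fun n => (1 - lam * mu) ^ n * bar lam f n) (h0 : ∀ n, 0 ≤ bar lam f n)
    (hf : Monotone (bar lam f)) :
    bar lam (fun y => ∑' t : ℕ, β ^ t * mean lam mu (threshold k) t y f) =
      discSum (lam * mu) β k (bar lam f) := by
  have hp : 0 < lam * mu := by positivity
  have hp1 : lam * mu ≤ 1 := mul_le_one₀ hlam1 hmu.le hmu1
  have hsum := summable_discSum hp hp1 hs h0 hf hβ hβ1 k
  have hmean : ∀ y : State, Summable fun t : ℕ => β ^ t * mean lam mu (threshold k) t y f := by
    intro y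
    rw [← summable_nat_add_iff 1]
    refine (((hsum y.2).mul_left (β * (1 - mu * attempt (threshold k) y))).add
      ((hsum 0).mul_left (β * (mu * attempt (threshold k) y)))).congr fun t => ?_
    rw [mean_succ, pow_succ]
    ring
  funext n
  have h1 := ((hmean (true, n.succPNat)).hasSum.mul_left lam).add
    ((hmean (false, n.succPNat)).hasSum.mul_left (1 - lam))
  refine h1.unique ((hsum n).hasSum.congr_fun fun t => ?_)
  rw [← bar_mean, bar]
  ring

theorem bar_cost (lam : ℝ) (c : ℕ+ → ℝ) : bar lam (fun z => c z.2) = costSeq c := by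
  funext n
  simp only [bar, costSeq]
  ring

theorem bar_attempt (lam : ℝ) (k : ℕ) :
    bar lam (attempt (threshold k)) = fun n => if k ≤ n then lam else 0 := by
  funext n
  have h := prob_threshold k n
  rw [prob] at h
  simp [bar, attempt, h]

/-- The initial actions differ only through a reset of probability μ, so the marginal cost is β μ
times the discounted total at i minus that at 0. -/
theorem tendsto_margCost (hlam : 0 < lam) (hlam1 : lam ≤ 1) (hmu : 0 < mu) (hmu1 : mu ≤ 1)
    (hc : ∀ i, 0 ≤ c i) (hmono : Monotone c)
    (hsum : Summable fun i : ℕ+ => c i * (1 - lam * mu) ^ (i : ℕ)) (k : ℕ) (i : ℕ+) :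
    Tendsto (fun β => margCost lam mu c β k i) (𝓝[<] 1)
      (𝓝 (mu * relCost (lam * mu) 0 (costSeq c) k i)) := by
  have hp : 0 < lam * mu := by positivity
  have hp1 : lam * mu ≤ 1 := mul_le_one₀ hlam1 hmu.le hmu1
  have ha := monotone_costSeq hmono
  have hs := summable_costSeq hsum
  have h0 : ∀ n, 0 ≤ costSeq c n := fun n => hc _
  have h := (tendsto_id_left.mul_const mu).mul (tendsto_discSum_sub hp hp1 hs h0 ha k i)
  rw [one_mul] at h
  refine h.congr' ?_
  filter_upwards [eventually_left_one] with β hβ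
  have hb : bar lam (discCost lam mu c β k) = discSum (lam * mu) β k (costSeq c) := by
    have := bar_tsum_mean hlam hlam1 hmu hmu1 hβ.1.le hβ.2 k (fun z => c z.2)
    rw [bar_cost] at this
    exact this hs h0 ha
  rw [margCost, initCost, initCost, (hasSum_trans lam mu false true i _).tsum_eq,
    (hasSum_trans lam mu true true i _).tsum_eq, hb]
  simp
  ring

theorem tendsto_margWork (hlam : 0 < lam) (hlam1 : lam ≤ 1) (hmu : 0 < mu) (hmu1 : mu ≤ 1)
    (k : ℕ) (i : ℕ+) :
    Tendsto (fun β => margWork lam mu β k i) (𝓝[<] 1)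
      (𝓝 (1 - mu * relCost (lam * mu) 0 (fun n => if k ≤ n then lam else 0) k i)) := by
  have hp : 0 < lam * mu := by positivity
  have hp1 : lam * mu ≤ 1 := mul_le_one₀ hlam1 hmu.le hmu1
  -- The mean number of attempts in a slot given only the age: a packet is present with probability
  -- λ.
  set ρ : ℕ → ℝ := fun n => if k ≤ n then lam else 0 with hρ
  have h0 : ∀ n, 0 ≤ ρ n := fun n => by
    simp only [hρ]
    split_ifs <;> simp [hlam.le]
  have hle : ∀ n, ρ n ≤ lam := fun n => by
    simp only [hρ]
    split_ifs <;> simp [hlam.le]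
  have ha : Monotone ρ := fun m n hmn => by
    simp only [hρ]
    split_ifs with h1 h2 <;> first | omega | simp [hlam.le]
  have hq : 0 ≤ 1 - lam * mu := by linarith
  have hs : Summable fun n => (1 - lam * mu) ^ n * ρ n :=
    (summable_const_mul_pow hq (by linarith) lam).of_nonneg_of_le
      (fun n => mul_nonneg (pow_nonneg hq n) (h0 n))
      fun n => mul_le_mul_of_nonneg_left (hle n) (pow_nonneg hq n)
  have h := ((tendsto_id_left.mul_const mu).mul
    (tendsto_discSum_sub hp hp1 hs h0 ha k i)).const_sub 1
  rw [one_mul] at h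
  refine h.congr' ?_
  filter_upwards [eventually_left_one] with β hβ
  have hb : bar lam (discWork lam mu β k) = discSum (lam * mu) β k ρ := by
    have := bar_tsum_mean hlam hlam1 hmu hmu1 hβ.1.le hβ.2 k (attempt (threshold k))
    rw [bar_attempt] at this
    exact this hs h0 ha
  rw [margWork, initWork, initWork, (hasSum_trans lam mu false true i _).tsum_eq,
    (hasSum_trans lam mu true true i _).tsum_eq, hb]
  simp
  ring

/-- The closed form of the average marginal work metric. -/
theorem one_sub_relCost_attempt (hlam : 0 < lam) (hlam1 : lam ≤ 1) (hmu : 0 < mu) (hmu1 : mu ≤ 1)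
    (k n : ℕ) : 1 - mu * relCost (lam * mu) 0 (fun n => if k ≤ n then lam else 0) k n =
      (1 + (k - min n k : ℕ) * (lam * mu)) / (1 + k * (lam * mu)) := by
  have hp : 0 < lam * mu := by positivity
  have hp1 : lam * mu ≤ 1 := mul_le_one₀ hlam1 hmu.le hmu1
  set ρ : ℕ → ℝ := fun n => if k ≤ n then lam else 0 with hρ
  have hcum : ∀ m, m ≤ k → cum ρ m = 0 := fun m hm =>
    Finset.sum_eq_zero fun j hj => if_neg (by have := Finset.mem_range.1 hj; omega)
  have htail : ∀ m, k ≤ m → tail (1 - lam * mu) ρ m = 1 / mu := by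
    intro m hm
    have h1 : tail (1 - lam * mu) ρ m = tail (1 - lam * mu) (fun _ => lam) m := by
      simp only [tail, hρ, if_pos (hm.trans (Nat.le_add_right m _))]
    rw [h1, tail_const (by linarith) (by linarith), sub_sub_cancel]
    field_simp
  have hgain : gain (lam * mu) 0 ρ k = lam / (1 + k * (lam * mu)) := by
    rw [gain, hcum k le_rfl, htail k le_rfl]
    congr 1
    field_simp
    ring
  have hpos : 0 < 1 + k * (lam * mu) := by positivity
  rcases le_total n k with hn | hn
  · rw [relCost_of_le hn, hcum n hn, hgain, min_eq_left hn, Nat.cast_sub hn]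
    field_simp
    ring
  · rw [relCost_of_ge hp hn, htail n hn, hgain, min_eq_right hn]
    field_simp
    simp

theorem isAvgMPIndex_closedForm (hlam : 0 < lam) (hlam1 : lam ≤ 1) (hmu : 0 < mu) (hmu1 : mu ≤ 1)
    (hc : ∀ i, 0 ≤ c i) (hmono : Monotone c)
    (hsum : Summable fun i : ℕ+ => c i * (1 - lam * mu) ^ (i : ℕ)) :
    IsAvgMPIndex lam mu c (closedForm lam mu c) := by
  have hp : 0 < lam * mu := by positivity
  refine ⟨_, _, fun i => tendsto_margCost hlam hlam1 hmu hmu1 hc hmono hsum i i,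
    fun k i => tendsto_margWork hlam hlam1 hmu hmu1 k i, fun k i => ?_, fun i => ?_⟩
  · rw [one_sub_relCost_attempt hlam hlam1 hmu hmu1]
    positivity
  -- At k = i the work metric is 1 / (1 + i p), which cancels the denominator of `gain`.
  · rw [one_sub_relCost_attempt hlam hlam1 hmu hmu1, closedForm_eq, relCost_of_le le_rfl, index,
      gain, min_self, Nat.sub_self]
    have hpos : 0 < 1 + ((i : ℕ) : ℝ) * (lam * mu) := by positivity
    field_simp
    simp
    ring

end Marginal

end AoI

end


theorem mainTheorem2 (lam mu : ℝ) (hlam : 0 < lam) (hlam1 : lam ≤ 1) (hmu : 0 < mu) (hmu1 : mu ≤ 1)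
    (c : ℕ+ → ℝ) (hc : ∀ i, 0 ≤ c i) (hmono : Monotone c)
    (hsum : Summable fun i : ℕ+ => c i * (1 - lam * mu) ^ (i : ℕ)) :
    AoI.ThresholdIndexable lam mu c ∧
    AoI.IsWhittleIndex lam mu c (AoI.closedForm lam mu c) ∧
    AoI.IsAvgMPIndex lam mu c (AoI.closedForm lam mu c) := by
  obtain ⟨h, hw⟩ := AoI.isWhittleIndex_closedForm hlam hlam1 hmu hmu1 hc hmono hsum
  exact ⟨AoI.thresholdIndexable_of_isWhittleIndex h hw, h,
    AoI.isAvgMPIndex_closedForm hlam hlam1 hmu hmu1 hc hmono hsum⟩
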